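/- Let $g\ge 2$ and let $$G_g=\{\mathcal A=(A_1,\dots,A_{2g})\in SL_2(\mathbf R)^{2g}:\ [A_1,A_2][A_3,A_4]\cdots[A_{2g-1},A_{2g}]=I\},$$ where "almost every $\mathcal A\in G_g$" refers to the $(6g-3)$-dimensional Hausdorff (i.e. smooth volume) measure on $G_g\subset\mathbf R^{8g}$. For a word $W$ in the letters $A_1^{\pm1},\dots,A_{2g}^{\pm1}$, let $|W|$ be the length of the freely reduced word and let $W(\mathcal A)\in SL_2(\mathbf R)$ be its value. Let $l(W,\mathcal A)$ be the length of the closed geodesic in the homotopy class defined by $W$, i.e. the distance by which $W(\mathcal A)$ translates along itself a geodesic line of the hyperbolic plane $\mathbf H$ that it leaves invariant (so $l(W,\mathcal A)=0$ if $W(\mathcal A)=\pm I$), with $l(W,\mathcal A)=0$ if $W(\mathcal A)$ translates no geodesic line along itself. (1) For each $\eta>0$ and almost every $\mathcal A\in G_g$ there is a constant $K=K(\mathcal A)>0$ such that for every pair of words $W_1,W_2$ either $l(W_1,\mathcal A)=l(W_2,\mathcal A)$ or $$|l(W_1,\mathcal A)-l(W_2,\mathcal A)|\ \ge\ K\,(4g-1)^{-[(2g+4)(4g-2)+\eta]\,\max^2(|W_1|,|W_2|)}.$$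 (2) For almost every $\mathcal A\in G_g$ that defines a closed hyperbolic surface of genus $g$ (that is, the action on $\mathbf H$ of the surface group $\langle a_1,\dots,a_{2g}\mid [a_1,a_2]\cdots[a_{2g-1},a_{2g}]=1\rangle$ given by $a_i\mapsto A_i$ is free, properly discontinuous and cocompact) there are constants $K,R>0$ depending on $\mathcal A$ such that for every pair of words $W_1,W_2$ either $l(W_1,\mathcal A)=l(W_2,\mathcal A)$ or $$|l(W_1,\mathcal A)-l(W_2,\mathcal A)|\ \ge\ K\,e^{-R\,l(W_1,\mathcal A)^2}.$$ -/

import Mathlib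

open scoped MatrixGroups UpperHalfPlane MeasureTheory

noncomputable section

/-- The product of commutators `[A₁, A₂] [A₃, A₄] ⋯ [A_{2g-1}, A_{2g}]` (in this order) of a
`2g`-tuple of group elements; the tuple is indexed from `0`. -/
def commutatorProduct {G : Type*} [Group G] {g : ℕ} (A : Fin (2 * g) → G) : G :=
  (List.ofFn fun i : Fin g =>
    let a := A ⟨2 * (i : ℕ), by omega⟩
    let b := A ⟨2 * (i : ℕ) + 1, by omega⟩
    a * b * a⁻¹ * b⁻¹).prod

/-- `G_g`: the `2g`-tuples in `SL₂(ℝ)` with `[A₁, A₂] ⋯ [A_{2g-1}, A_{2g}] = I`. -/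
def surfaceTuples (g : ℕ) : Set (Fin (2 * g) → SL(2, ℝ)) :=
  {A | commutatorProduct A = 1}

/-- The vector in `ℝ^{8g}` of all the matrix entries of a tuple. -/
def entries {g : ℕ} (A : Fin (2 * g) → SL(2, ℝ)) : Fin (2 * g) × Fin 2 × Fin 2 → ℝ :=
  fun p => A p.1 p.2.1 p.2.2

/-- `P` holds for almost every `A ∈ G_g`: the exceptional tuples form a null set for the
`(6g-3)`-dimensional Hausdorff measure of the space `ℝ^{8g}` of matrix entries. For `g ≥ 2` the set
`G_g` is, off a subset of smaller dimension, an embedded smooth manifold of dimension `6g-3`, on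
which this measure has the null sets of the Lebesgue (smooth volume) class. The null sets do not
depend on which norm of `ℝ^{8g}` is used. -/
def AlmostEverySurfaceTuple (g : ℕ) (P : (Fin (2 * g) → SL(2, ℝ)) → Prop) : Prop :=
  μH[6 * (g : ℝ) - 3] (entries '' {A | A ∈ surfaceTuples g ∧ ¬ P A}) = 0

/-- The value `W(A)` of a word `W` in the letters `A₁^{±1}, …, A_{2g}^{±1}`. Words are taken up to
free reduction; the length `|W|` is then the length of the reduced word, `FreeGroup.norm W`. -/
def evalWord {g : ℕ} (A : Fin (2 * g) → SL(2, ℝ)) : FreeGroup (Fin (2 * g)) →* SL(2, ℝ) :=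
  FreeGroup.lift A

/-- `ℓ` is the length of a closed geodesic in the homotopy class defined by `W`: some lift of the
geodesic to the hyperbolic plane, a complete geodesic `c` of unit speed, is translated by `W(A)`
along itself by `ℓ`. (When `W(A)` acts trivially on the hyperbolic plane, `ℓ = 0`.) -/
def IsClosedGeodesicLength {g : ℕ} (W : FreeGroup (Fin (2 * g))) (A : Fin (2 * g) → SL(2, ℝ))
    (ℓ : ℝ) : Prop :=
  0 ≤ ℓ ∧ ∃ c : ℝ → ℍ, Isometry c ∧ ∀ t : ℝ, c (t + ℓ) = evalWord A W • c t

/-- `l(W, A)`: the length of the closed geodesic in the homotopy class defined by `W`. There is at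
most one such length (see `IsClosedGeodesicLength.eq`); if there is none, which cannot happen when
`A` defines a closed hyperbolic surface, the value is `0`. -/
def geodesicLength {g : ℕ} (W : FreeGroup (Fin (2 * g))) (A : Fin (2 * g) → SL(2, ℝ)) : ℝ :=
  sInf {ℓ : ℝ | IsClosedGeodesicLength W A ℓ}

/-- `A` defines a closed hyperbolic surface `S_A = ℍ / ⟨A₁, …, A_{2g}⟩` of genus `g`, with the
`A_i` as standard generators of its fundamental group: `A ∈ G_g`, and the group generated by the
`A_i` acts properly discontinuously and cocompactly on the hyperbolic plane, and only those words
which are trivial in the surface group have a fixed point (so that the action of the surface group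
is free, and in particular faithful). -/
structure DefinesSurface {g : ℕ} (A : Fin (2 * g) → SL(2, ℝ)) : Prop where
  mem : A ∈ surfaceTuples g
  free : ∀ (W : FreeGroup (Fin (2 * g))) (z : ℍ), evalWord A W • z = z →
    W ∈ Subgroup.normalClosure {commutatorProduct (FreeGroup.of : Fin (2 * g) → _)}
  properlyDiscontinuous : ∀ C : Set ℍ, IsCompact C →
    {γ : SL(2, ℝ) | γ ∈ (evalWord A).range ∧ ∃ z ∈ C, γ • z ∈ C}.Finite
  cocompact : ∃ C : Set ℍ, IsCompact C ∧ ∀ z : ℍ, ∃ γ ∈ (evalWord A).range, γ • z ∈ C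

theorem IsClosedGeodesicLength.le {g : ℕ} {W : FreeGroup (Fin (2 * g))}
    {A : Fin (2 * g) → SL(2, ℝ)} {ℓ ℓ' : ℝ} (h : IsClosedGeodesicLength W A ℓ)
    (h' : IsClosedGeodesicLength W A ℓ') : ℓ ≤ ℓ' := by
  obtain ⟨h0, c, hc, hcW⟩ := h
  obtain ⟨h0', c', hc', hcW'⟩ := h'
  have iter : ∀ (d : ℝ → ℍ) (x : ℝ), (∀ t, d (t + x) = evalWord A W • d t) →
      ∀ n : ℕ, d (n * x) = (evalWord A W) ^ n • d 0 := by
    intro d x hd n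
    induction n with
    | zero => simp
    | succ n ih =>
      have : ((n + 1 : ℕ) : ℝ) * x = n * x + x := by push_cast; ring
      rw [this, hd, ih, pow_succ', mul_smul]
  by_contra hlt
  push Not at hlt
  obtain ⟨n, hn⟩ := exists_nat_gt (2 * dist (c 0) (c' 0) / (ℓ - ℓ'))
  rw [div_lt_iff₀ (by linarith)] at hn
  have e1 : dist (c 0) (c (n * ℓ)) = n * ℓ := by
    rw [hc.dist_eq, Real.dist_eq, zero_sub, abs_neg, abs_of_nonneg (by positivity)]
  have e2 : dist (c' 0) (c' (n * ℓ')) = n * ℓ' := by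
    rw [hc'.dist_eq, Real.dist_eq, zero_sub, abs_neg, abs_of_nonneg (by positivity)]
  have e3 : dist (c (n * ℓ)) (c' (n * ℓ')) = dist (c 0) (c' 0) := by
    rw [iter c ℓ hcW, iter c' ℓ' hcW', dist_smul]
  have t1 := dist_triangle4 (c 0) (c' 0) (c' (n * ℓ')) (c (n * ℓ))
  rw [dist_comm (c' (n * ℓ'))] at t1
  nlinarith

/-- The length of the closed geodesic is well defined. -/
theorem IsClosedGeodesicLength.eq {g : ℕ} {W : FreeGroup (Fin (2 * g))}
    {A : Fin (2 * g) → SL(2, ℝ)} {ℓ : ℝ} (h : IsClosedGeodesicLength W A ℓ) :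
    geodesicLength W A = ℓ := by
  have : {ℓ' : ℝ | IsClosedGeodesicLength W A ℓ'} = {ℓ} := by
    ext x
    exact ⟨fun hx => le_antisymm (hx.le h) (h.le hx), fun hx => by rw [hx]; exact h⟩
  rw [geodesicLength, this, csInf_singleton]

end

/-! A hyperbolic element has `cosh l = tr² / 2 - 1` (`cosh_geodesicLength`), and traces grow at most
exponentially in the word length. Up to an exponential factor, a gap between lengths is therefore a
gap between squared traces, and it suffices to bound the latter from below.

The tuples of the surface relation are parametrised by matrices whose entries are integer
polynomials (`exists_representedAt_of_mem_surfaceTuples`). The matrices are needed only up to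
scaling and a common conjugation. Conjugating the inverse of the first commutator to a companion
matrix leaves one parameter for its trace, three for each generator after the fourth, three for each
of the first two pairs and two for the conjugator. That makes `6g - 3`, the dimension of `G_g`, and
the entries have degree at most `8g - 12`. Tuples where this breaks down need only `6g - 4`
parameters and form a null set. The charts are countably many and locally Lipschitz, so null sets of
parameters give Hausdorff null sets of tuples (`hausdorffMeasure_entries_image_eq_zero`).

In a chart the trace gap of two words is, up to a controlled positive factor, the value of an
integer polynomial `gapNumerator` of degree at most `D`, linear in the total word length `n`. A
nonzero integer polynomial of degree at most `D` is below `θ ^ D` on a box only on a set of measure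
`O(D θ)` (`volume_abs_aeval_lt_le`). With `θ = r ^ n` and `r < 1 / (4g - 1)` these measures are
summable over all pairs of words, so Borel-Cantelli (`ae_exists_le_abs_aeval_gapNumerator`) gives a
lower bound `K r ^ (D n)`. This is the source of the quadratic exponent; its coefficient stays below
the claimed one, and `η` absorbs the exponential factors.

For a closed surface, a Milnor-Švarc argument along the axis (`DefinesSurface.exists_norm_le`)
replaces each word by one of the same geodesic length whose word length is linear in it, which turns
the first bound into the second. -/

/-! ### Small values of integer polynomials -/

open MeasureTheory in
/-- A real polynomial of degree at most `d` with large leading coefficient is small only on a small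
set. -/
theorem volume_abs_eval_lt_le (q : Polynomial ℝ) (d : ℕ) (hd : q.natDegree ≤ d) (θ : ℝ)
    (hθ : 0 < θ) (hq : θ ^ (d - q.natDegree) ≤ |q.leadingCoeff|) :
    volume {x : ℝ | |q.eval x| < θ ^ d} ≤ ENNReal.ofReal (2 * d * θ) := by
  set Q := q.map (algebraMap ℝ ℂ) with hQ
  have hsp : Q.Splits := IsAlgClosed.splits Q
  have hinj : Function.Injective (algebraMap ℝ ℂ) := (algebraMap ℝ ℂ).injective
  have hcard : Q.roots.card = q.natDegree := by
    rw [← hsp.natDegree_eq_card_roots, hQ, Polynomial.natDegree_map]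
  have hev : ∀ x : ℝ, |q.eval x| =
      |q.leadingCoeff| * (Q.roots.map fun z => ‖(x : ℂ) - z‖).prod := by
    intro x
    have h1 : Q.eval (x : ℂ) = ((q.eval x : ℝ) : ℂ) := by
      rw [hQ, Polynomial.eval_map_algebraMap]
      exact Polynomial.aeval_algebraMap_apply ℂ x q
    have h2 := hsp.eval_eq_prod_roots (x : ℂ)
    rw [h1] at h2
    have h3 := congrArg norm h2
    rw [Complex.norm_real, Real.norm_eq_abs, norm_mul, hQ,
      Polynomial.leadingCoeff_map_of_injective hinj, ← hQ] at h3
    rw [h3]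
    congr 1
    · simp
    · have := map_multiset_prod (normHom : ℂ →*₀ ℝ) (Q.roots.map fun a => (x : ℂ) - a)
      rw [Multiset.map_map] at this
      exact this
  -- If `x` is at distance at least `θ` from the real part of every complex root, all factors of the
  -- factorisation are at least `θ`, and with the leading coefficient they give at least `θ ^ d`.
  have hsub : {x : ℝ | |q.eval x| < θ ^ d} ⊆
      ⋃ z ∈ Q.roots.toFinset, Metric.ball (z.re) θ := by
    intro x hx
    simp only [Set.mem_ofPred_eq] at hx
    by_contra hcon
    simp only [Set.mem_iUnion, Multiset.mem_toFinset, not_exists, Metric.mem_ball, not_lt] at hcon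
    have hprod : θ ^ q.natDegree ≤ (Q.roots.map fun z => ‖(x : ℂ) - z‖).prod := by
      rw [← hcard]
      have := Multiset.prod_map_le_prod_map₀ (s := Q.roots) (fun _ => θ) (fun z => ‖(x : ℂ) - z‖)
        (fun _ _ => hθ.le) (fun z hz => by
          refine (hcon z hz).trans ?_
          rw [Real.dist_eq]
          have := Complex.abs_re_le_norm ((x : ℂ) - z)
          simpa using this)
      simpa using this
    have : θ ^ d ≤ |q.eval x| := by
      rw [hev]
      calc θ ^ d = θ ^ (d - q.natDegree) * θ ^ q.natDegree := by rw [← pow_add]; congr 1; omega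
        _ ≤ _ := by gcongr
    linarith
  calc _ ≤ volume (⋃ z ∈ Q.roots.toFinset, Metric.ball (z.re) θ) := measure_mono hsub
    _ ≤ ∑ z ∈ Q.roots.toFinset, volume (Metric.ball (z.re) θ) := measure_biUnion_finset_le _ _
    _ = Q.roots.toFinset.card * ENNReal.ofReal (2 * θ) := by simp [Real.volume_ball]
    _ ≤ (d : ℕ) * ENNReal.ofReal (2 * θ) := by
        gcongr
        exact (Multiset.toFinset_card_le _).trans (hcard.le.trans hd)
    _ = _ := by
        rw [← ENNReal.ofReal_natCast, ← ENNReal.ofReal_mul (by positivity)]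
        congr 1; ring

theorem MvPolynomial.aeval_cons_eq_eval_map {n : ℕ} (s : Fin n → ℝ) (y : ℝ)
    (f : MvPolynomial (Fin (n + 1)) ℤ) :
    MvPolynomial.aeval (Fin.cons y s : Fin (n + 1) → ℝ) f =
      Polynomial.eval y (Polynomial.map (MvPolynomial.aeval (R := ℤ) s).toRingHom
        (MvPolynomial.finSuccEquiv ℤ n f)) := by
  induction f using MvPolynomial.induction_on with
  | C a => simp
  | add p q hp hq => simp [hp, hq]
  | mul_X p i hp =>
    rw [map_mul, hp, map_mul, Polynomial.map_mul, Polynomial.eval_mul]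
    congr 1
    refine Fin.cases ?_ (fun j => ?_) i
    · simp [MvPolynomial.finSuccEquiv_X_zero]
    · simp [MvPolynomial.finSuccEquiv_X_succ]

open MeasureTheory in
/-- A nonzero integer polynomial of total degree at most `d` is smaller than `θ ^ d` only on a
small part of a cube. -/
theorem volume_abs_aeval_lt_le {M θ : ℝ} (hM : 1 ≤ M) (hθ : 0 < θ) (hθ1 : θ ≤ 1) (N : ℕ) :
    ∀ (d : ℕ) (p : MvPolynomial (Fin N) ℤ), p ≠ 0 → p.totalDegree ≤ d →
      volume {x : Fin N → ℝ | (∀ i, |x i| ≤ M) ∧ |MvPolynomial.aeval x p| < θ ^ d} ≤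
        ENNReal.ofReal (N * (2 * d * θ) * (2 * M) ^ N) := by
  induction N with
  | zero =>
    intro d p hp _
    obtain ⟨a, rfl⟩ := MvPolynomial.C_surjective (Fin 0) p
    have ha : a ≠ 0 := fun h => hp (by simp [h])
    have : {x : Fin 0 → ℝ | (∀ i, |x i| ≤ M) ∧
        |MvPolynomial.aeval x (MvPolynomial.C a : MvPolynomial (Fin 0) ℤ)| < θ ^ d} = ∅ := by
      ext x
      simp only [Set.mem_ofPred_eq, Set.mem_empty_iff_false, iff_false, not_and, not_lt]
      intro _
      -- In this estimate integrality of the coefficients enters only here.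
      have h1 : (1 : ℝ) ≤ |(a : ℝ)| := by exact_mod_cast Int.one_le_abs ha
      have h2 := pow_le_one₀ hθ.le hθ1 (n := d)
      have h3 : MvPolynomial.aeval x (MvPolynomial.C a : MvPolynomial (Fin 0) ℤ) = (a : ℝ) := by
        simp
      rw [h3]
      linarith
    rw [this]; simp
  | succ N ih =>
    intro d p hp hdeg
    set F := MvPolynomial.finSuccEquiv ℤ N p with hF
    have hF0 : F ≠ 0 := by simpa [hF] using hp
    set k := F.natDegree with hk
    have hlc : F.coeff k ≠ 0 := by simpa [hk] using hF0
    have hdk : (F.coeff k).totalDegree + k ≤ d :=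
      (MvPolynomial.totalDegree_coeff_finSuccEquiv_add_le p k hlc).trans hdeg
    have hE' := ih (d - k) (F.coeff k) hlc (by omega)
    -- On `E'` the leading coefficient in the first variable is small, and slices get the trivial
    -- bound `2 * M`. Off `E'` the one-variable estimate applies, since the degree splits as `(d -
    -- k) + k`.
    set E' := {x : Fin N → ℝ | (∀ i, |x i| ≤ M) ∧
      |MvPolynomial.aeval x (F.coeff k)| < θ ^ (d - k)} with hE'def
    have hcont : ∀ (n : ℕ) (q : MvPolynomial (Fin n) ℤ),
        Continuous fun x : Fin n → ℝ => MvPolynomial.aeval x q := by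
      intro n q
      simp only [MvPolynomial.aeval_def, MvPolynomial.eval₂_eq]
      fun_prop
    have hbox : ∀ n : ℕ, IsClosed {x : Fin n → ℝ | ∀ i, |x i| ≤ M} := by
      intro n
      simp only [Set.ofPred_forall]
      exact isClosed_iInter fun i => isClosed_le (by fun_prop) (by fun_prop)
    have hmeas : ∀ (n e : ℕ) (q : MvPolynomial (Fin n) ℤ), MeasurableSet
        {x : Fin n → ℝ | (∀ i, |x i| ≤ M) ∧ |MvPolynomial.aeval x q| < θ ^ e} := by
      intro n e q
      exact (hbox n).measurableSet.inter
        (isOpen_lt (hcont n q).abs continuous_const).measurableSet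
    have hmp := (volume_preserving_piFinSuccAbove (fun _ : Fin (N + 1) => ℝ) 0).symm
    rw [← hmp.measure_preimage (hmeas _ _ _).nullMeasurableSet]
    rw [Measure.volume_eq_prod, Measure.prod_apply_symm (hmp.measurable (hmeas _ _ _))]
    have hslice : ∀ y : Fin N → ℝ,
        volume ((fun x : ℝ => (x, y)) ⁻¹'
          ((MeasurableEquiv.piFinSuccAbove (fun _ : Fin (N + 1) => ℝ) 0).symm ⁻¹'
          {x | (∀ i, |x i| ≤ M) ∧ |MvPolynomial.aeval x p| < θ ^ d})) ≤
        E'.indicator (fun _ => ENNReal.ofReal (2 * M)) y +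
          {x : Fin N → ℝ | ∀ i, |x i| ≤ M}.indicator (fun _ => ENNReal.ofReal (2 * d * θ)) y := by
      intro y
      have hset : ((fun x : ℝ => (x, y)) ⁻¹'
          ((MeasurableEquiv.piFinSuccAbove (fun _ : Fin (N + 1) => ℝ) 0).symm ⁻¹'
          {x | (∀ i, |x i| ≤ M) ∧ |MvPolynomial.aeval x p| < θ ^ d})) =
          {x0 : ℝ | (|x0| ≤ M ∧ ∀ i, |y i| ≤ M) ∧
            |Polynomial.eval x0 (F.map (MvPolynomial.aeval (R := ℤ) y).toRingHom)| < θ ^ d} := by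
        ext x0
        have : (MeasurableEquiv.piFinSuccAbove (fun _ : Fin (N + 1) => ℝ) 0).symm (x0, y) =
            (Fin.cons x0 y : Fin (N + 1) → ℝ) := by
          simp only [MeasurableEquiv.piFinSuccAbove, MeasurableEquiv.symm_mk,
            MeasurableEquiv.coe_mk, Fin.insertNthEquiv_zero, Equiv.symm_symm]
          rfl
        simp only [Set.mem_preimage, Set.mem_ofPred_eq, this, Fin.forall_fin_succ, Fin.cons_zero,
          Fin.cons_succ, MvPolynomial.aeval_cons_eq_eval_map, hF]
      rw [hset]
      by_cases hy : ∀ i, |y i| ≤ M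
      · by_cases hyE : y ∈ E'
        · rw [Set.indicator_of_mem hyE]
          refine le_add_right ?_
          calc _ ≤ volume (Set.Icc (-M) M) := by
                apply measure_mono
                intro x hx
                exact abs_le.mp hx.1.1
            _ = _ := by rw [Real.volume_Icc]; congr 1; ring
        · rw [Set.indicator_of_notMem hyE, zero_add, Set.indicator_of_mem (by exact hy)]
          have hlow : θ ^ (d - k) ≤ |MvPolynomial.aeval y (F.coeff k)| := by
            by_contra h
            exact hyE ⟨hy, not_le.mp h⟩
          have hne : (MvPolynomial.aeval (R := ℤ) y).toRingHom F.leadingCoeff ≠ 0 := by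
            intro h0
            have h0' : MvPolynomial.aeval y (F.coeff k) = 0 := h0
            rw [h0', abs_zero] at hlow
            exact absurd hlow (not_le.mpr (by positivity))
          have hnd : (F.map (MvPolynomial.aeval (R := ℤ) y).toRingHom).natDegree = k :=
            Polynomial.natDegree_map_of_leadingCoeff_ne_zero _ hne
          refine (measure_mono ?_).trans (volume_abs_eval_lt_le
            (F.map (MvPolynomial.aeval (R := ℤ) y).toRingHom) d (by omega) θ hθ ?_)
          · intro x hx; exact hx.2
          · rw [hnd, Polynomial.leadingCoeff, hnd, Polynomial.coeff_map]
            exact hlow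
      · have : {x0 : ℝ | (|x0| ≤ M ∧ ∀ i, |y i| ≤ M) ∧
            |Polynomial.eval x0 (F.map (MvPolynomial.aeval (R := ℤ) y).toRingHom)| < θ ^ d} =
            ∅ := by
          ext x; simp [hy]
        rw [this]; simp
    have hvbox : volume {x : Fin N → ℝ | ∀ i, |x i| ≤ M} = ENNReal.ofReal ((2 * M) ^ N) := by
      have : {x : Fin N → ℝ | ∀ i, |x i| ≤ M} = Set.Icc (fun _ => -M) (fun _ => M) := by
        ext x; simp [Set.mem_Icc, Pi.le_def, abs_le, forall_and]
      rw [this, Real.volume_Icc_pi]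
      rw [Finset.prod_const, Finset.card_univ, Fintype.card_fin, sub_neg_eq_add, ← two_mul,
        ← ENNReal.ofReal_pow (by linarith)]
    refine (lintegral_mono hslice).trans ?_
    rw [lintegral_add_left ((measurable_const).indicator (hmeas _ _ _)),
      lintegral_indicator_const (hmeas _ _ _), lintegral_indicator_const (hbox N).measurableSet,
      hvbox]
    have hd0 : ((d - k : ℕ) : ℝ) ≤ d := by exact_mod_cast Nat.sub_le d k
    calc _ ≤ ENNReal.ofReal (2 * M) * ENNReal.ofReal (N * (2 * (d - k : ℕ) * θ) * (2 * M) ^ N) +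
          ENNReal.ofReal (2 * d * θ) * ENNReal.ofReal ((2 * M) ^ N) := by gcongr
      _ = ENNReal.ofReal ((2 * M) * (N * (2 * (d - k : ℕ) * θ) * (2 * M) ^ N) +
          (2 * d * θ) * (2 * M) ^ N) := by
          rw [← ENNReal.ofReal_mul (by positivity), ← ENNReal.ofReal_mul (by positivity),
            ← ENNReal.ofReal_add (by positivity) (by positivity)]
      _ ≤ _ := by
          apply ENNReal.ofReal_le_ofReal
          have h1 : (2 * d * θ) * (2 * M) ^ N ≤ (2 * d * θ) * (2 * M) ^ (N + 1) := by
            gcongr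
            · linarith
            · omega
          have h2 : (2 * M) * (N * (2 * (d - k : ℕ) * θ) * (2 * M) ^ N) ≤
              (2 * M) * (N * (2 * d * θ) * (2 * M) ^ N) := by gcongr
          push_cast
          calc _ ≤ (2 * M) * (N * (2 * d * θ) * (2 * M) ^ N) + (2 * d * θ) * (2 * M) ^ (N + 1) := by
                linarith
            _ = _ := by ring

/-! ### Translation lengths and traces -/

/-- This turns displacement into the squared Frobenius norm of a matrix, so that relations between
`γ` and `γ ^ 2` become polynomial identities. -/
theorem two_mul_cosh_dist_I_smul (γ : SL(2, ℝ)) :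
    2 * Real.cosh (dist UpperHalfPlane.I (γ • UpperHalfPlane.I)) =
      γ 0 0 ^ 2 + γ 0 1 ^ 2 + γ 1 0 ^ 2 + γ 1 1 ^ 2 := by
  have hdet : γ 0 0 * γ 1 1 - γ 0 1 * γ 1 0 = 1 := by
    have := γ.det_coe; rwa [Matrix.det_fin_two] at this
  have hpos : 0 < γ 1 0 ^ 2 + γ 1 1 ^ 2 := by
    rcases eq_or_ne (γ 1 0) 0 with h | h
    · have : γ 1 1 ≠ 0 := fun h' => by simp [h, h'] at hdet
      positivity
    · positivity
  set a := γ 0 0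
  set b := γ 0 1
  set c := γ 1 0
  set d := γ 1 1
  have hne : (c : ℂ) * Complex.I + d ≠ 0 := by
    intro h
    have h1 := congrArg Complex.re h
    have h2 := congrArg Complex.im h
    simp at h1 h2
    rw [h1, h2] at hpos
    norm_num at hpos
  have hco : ((γ • UpperHalfPlane.I : ℍ) : ℂ) =
      ⟨(a * c + b * d) / (c ^ 2 + d ^ 2), 1 / (c ^ 2 + d ^ 2)⟩ := by
    have h := UpperHalfPlane.coe_specialLinearGroup_apply γ UpperHalfPlane.I
    rw [h]
    simp only [UpperHalfPlane.coe_I, Algebra.algebraMap_self, RingHom.id_apply]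
    rw [div_eq_iff hne]
    apply Complex.ext
    · simp
      field_simp
      linear_combination (-c) * hdet
    · simp
      field_simp
      linear_combination (d) * hdet
  rw [UpperHalfPlane.cosh_dist]
  have him : (γ • UpperHalfPlane.I : ℍ).im = 1 / (c ^ 2 + d ^ 2) := by
    rw [← UpperHalfPlane.coe_im, hco]
  rw [him, hco, Complex.dist_eq_re_im, Real.sq_sqrt (by positivity)]
  simp
  field_simp
  linear_combination (-(a*d-b*c) - 1) * hdet

theorem Matrix.SpecialLinearGroup.trace_conj_eq (g γ : SL(2, ℝ)) :
    (g⁻¹ * γ * g).1.trace = γ.1.trace := by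
  have : (g⁻¹ * γ * g).1 = (g⁻¹).1 * γ.1 * g.1 := rfl
  rw [this, Matrix.trace_mul_comm, ← mul_assoc]
  have h2 : g.1 * (g⁻¹).1 = 1 := by
    have := congrArg Subtype.val (mul_inv_cancel g)
    exact this
  rw [h2, one_mul]

/-- The displacement of `γ ^ 2` in terms of the displacement and the trace of `γ`. -/
theorem cosh_dist_sq_smul (γ : SL(2, ℝ)) (z : ℍ) :
    2 * Real.cosh (dist z ((γ * γ) • z)) =
      γ.1.trace ^ 2 * (2 * Real.cosh (dist z (γ • z))) - 2 * γ.1.trace ^ 2 + 2 := by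
  -- By transitivity and conjugation `z` becomes `I`. The identity is then the expansion of the
  -- squared Frobenius norm of `δ ^ 2 = tr δ • δ - 1` (Cayley-Hamilton).
  obtain ⟨g, rfl⟩ := MulAction.exists_smul_eq SL(2, ℝ) UpperHalfPlane.I z
  have key : ∀ δ : SL(2, ℝ), dist (g • UpperHalfPlane.I) (δ • g • UpperHalfPlane.I) =
      dist UpperHalfPlane.I ((g⁻¹ * δ * g) • UpperHalfPlane.I) := by
    intro δ
    rw [← dist_smul g⁻¹, inv_smul_smul, mul_smul, mul_smul]
  rw [key, key, ← Matrix.SpecialLinearGroup.trace_conj_eq g γ]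
  have : g⁻¹ * (γ * γ) * g = (g⁻¹ * γ * g) * (g⁻¹ * γ * g) := by group
  rw [this]
  generalize g⁻¹ * γ * g = δ
  rw [two_mul_cosh_dist_I_smul, two_mul_cosh_dist_I_smul]
  have hdet : δ 0 0 * δ 1 1 - δ 0 1 * δ 1 0 = 1 := by
    have := δ.det_coe; rwa [Matrix.det_fin_two] at this
  have e : ∀ i j, (δ * δ) i j = δ i 0 * δ 0 j + δ i 1 * δ 1 j := by
    intro i j
    have : (δ * δ) i j = (δ.1 * δ.1) i j := rfl
    rw [this, Matrix.mul_apply, Fin.sum_univ_two]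
  rw [e, e, e, e, Matrix.trace_fin_two]
  generalize h1 : δ 0 0 = a at *
  generalize h2 : δ 0 1 = b at *
  generalize h3 : δ 1 0 = c at *
  generalize h4 : δ 1 1 = d at *
  linear_combination (-2 * (a + d) ^ 2 + 2 * (a * d - b * c) + 2) * hdet

/-- Translation along a geodesic by a positive amount determines the trace. -/
theorem trace_sq_of_translates {γ : SL(2, ℝ)} {ℓ : ℝ} (hℓ : 0 < ℓ) {c : ℝ → ℍ} (hc : Isometry c)
    (hγ : ∀ t, c (t + ℓ) = γ • c t) : γ.1.trace ^ 2 = 2 * (Real.cosh ℓ + 1) := by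
  have h1 : γ • c 0 = c ℓ := by rw [← hγ]; simp
  have h2 : (γ * γ) • c 0 = c (2 * ℓ) := by rw [mul_smul, h1, ← hγ]; congr 1; ring
  have h := cosh_dist_sq_smul γ (c 0)
  rw [h1, h2, hc.dist_eq, hc.dist_eq, Real.dist_eq, Real.dist_eq, zero_sub, zero_sub, abs_neg,
    abs_neg, Real.cosh_abs, Real.cosh_abs, Real.cosh_two_mul] at h
  have h3 := Real.cosh_sq ℓ
  have h4 : 1 < Real.cosh ℓ := Real.one_lt_cosh.mpr hℓ.ne'
  -- On the axis `γ` and `γ * γ` displace by `ℓ` and `2 * ℓ`. The first factor is nonzero because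
  -- `ℓ` is positive.
  have h5 : (Real.cosh ℓ - 1) * (γ.1.trace ^ 2 - 2 * (Real.cosh ℓ + 1)) = 0 := by
    linear_combination (-h) / 2 - h3
  rcases mul_eq_zero.mp h5 with h6 | h6 <;> linarith

theorem Matrix.det_ne_zero_of_eigenvectors {A : Matrix (Fin 2) (Fin 2) ℝ} {x y : ℝ} (hxy : x ≠ y)
    {v w : Fin 2 → ℝ} (hv0 : v ≠ 0) (hw0 : w ≠ 0) (hv : A.mulVec v = x • v)
    (hw : A.mulVec w = y • w) : v 0 * w 1 - v 1 * w 0 ≠ 0 := by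
  intro hD
  obtain ⟨i, hi⟩ := Function.ne_iff.mp hv0
  have hprop : v i • w = w i • v := by
    ext j
    fin_cases i <;> fin_cases j <;> simp <;> linarith
  have h1 : A.mulVec (v i • w) = y • (v i • w) := by
    rw [Matrix.mulVec_smul, hw, smul_comm]
  have h2 : A.mulVec (v i • w) = x • (v i • w) := by
    rw [hprop, Matrix.mulVec_smul, hv, smul_comm]
  have h3 : (x - y) • (v i • w) = 0 := by rw [sub_smul, ← h1, ← h2, sub_self]
  rcases smul_eq_zero.mp h3 with h | h
  · exact hxy (sub_eq_zero.mp h)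
  · rcases smul_eq_zero.mp h with h | h
    · exact hi h
    · exact hw0 h

/-- The characteristic polynomial has two distinct positive roots with product 1. The eigenvectors
are the columns of the conjugator, the second divided by `D` to make the determinant 1. -/
theorem exists_conj_diagonal {γ : SL(2, ℝ)} (hγ : 2 < γ.1.trace) :
    ∃ (h dg : SL(2, ℝ)) (lam mu : ℝ), 1 < lam ∧ lam * mu = 1 ∧ dg.1 = !![lam, 0; 0, mu] ∧
      γ * h = h * dg := by
  have hdet : γ.1 0 0 * γ.1 1 1 - γ.1 0 1 * γ.1 1 0 = 1 := by
    have := γ.det_coe; rwa [Matrix.det_fin_two] at this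
  obtain ⟨s, hs0, hs2⟩ : ∃ s : ℝ, 0 < s ∧ s ^ 2 = γ.1.trace ^ 2 - 4 :=
    ⟨Real.sqrt (γ.1.trace ^ 2 - 4), Real.sqrt_pos.mpr (by nlinarith), Real.sq_sqrt (by nlinarith)⟩
  obtain ⟨lam, hlam⟩ : ∃ x, x = (γ.1.trace + s) / 2 := ⟨_, rfl⟩
  obtain ⟨mu, hmu⟩ : ∃ x, x = (γ.1.trace - s) / 2 := ⟨_, rfl⟩
  have hlm : lam * mu = 1 := by rw [hlam, hmu]; linear_combination (-1/4 : ℝ) * hs2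
  have hl1 : 1 < lam := by rw [hlam]; linarith
  have hev : ∀ x : ℝ, x ^ 2 - γ.1.trace * x + 1 = 0 →
      ∃ v : Fin 2 → ℝ, v ≠ 0 ∧ γ.1.mulVec v = x • v := by
    intro x hx
    obtain ⟨v, hv, hv'⟩ := Matrix.exists_mulVec_eq_zero_iff.mpr
      (show (γ.1 - x • (1 : Matrix (Fin 2) (Fin 2) ℝ)).det = 0 by
        rw [Matrix.trace_fin_two] at hx
        rw [Matrix.det_fin_two]
        simp only [Matrix.sub_apply, Matrix.smul_apply, Matrix.one_apply_eq, smul_eq_mul, ne_eq,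
          zero_ne_one, one_ne_zero, not_false_eq_true, Matrix.one_apply_ne]
        linear_combination hx + hdet)
    refine ⟨v, hv, ?_⟩
    rw [Matrix.sub_mulVec, Matrix.smul_mulVec, Matrix.one_mulVec, sub_eq_zero] at hv'
    exact hv'
  obtain ⟨v, hv, hv'⟩ := hev lam (by rw [hlam]; linear_combination (1/4 : ℝ) * hs2)
  obtain ⟨w, hw, hw'⟩ := hev mu (by rw [hmu]; linear_combination (1/4 : ℝ) * hs2)
  have hne : lam ≠ mu := by rw [hlam, hmu]; intro h; linarith
  have hD0 := Matrix.det_ne_zero_of_eigenvectors hne hv hw hv' hw'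
  have hv0 := congrFun hv' 0
  have hv1 := congrFun hv' 1
  have hw0 := congrFun hw' 0
  have hw1 := congrFun hw' 1
  simp only [Matrix.mulVec, dotProduct, Fin.sum_univ_two, Pi.smul_apply, smul_eq_mul]
    at hv0 hv1 hw0 hw1
  obtain ⟨D, hD⟩ : ∃ D, D = v 0 * w 1 - v 1 * w 0 := ⟨_, rfl⟩
  rw [← hD] at hD0
  have hdeth : (!![v 0, w 0 / D; v 1, w 1 / D]).det = 1 := by
    rw [Matrix.det_fin_two_of]; field_simp; rw [hD]; ring
  have hdetd : (!![lam, 0; 0, mu]).det = 1 := by rw [Matrix.det_fin_two_of]; linarith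
  refine ⟨⟨_, hdeth⟩, ⟨_, hdetd⟩, lam, mu, hl1, hlm, rfl, ?_⟩
  apply Subtype.ext
  change γ.1 * !![v 0, w 0 / D; v 1, w 1 / D] =
    !![v 0, w 0 / D; v 1, w 1 / D] * !![lam, 0; 0, mu]
  ext i j
  rw [Matrix.mul_apply, Matrix.mul_apply, Fin.sum_univ_two, Fin.sum_univ_two]
  fin_cases i <;> fin_cases j <;> simp
  · linarith
  · field_simp; linarith
  · linarith
  · field_simp; linarith

theorem coe_diagonal_smul {dg : SL(2, ℝ)} {lam mu : ℝ} (hlm : lam * mu = 1)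
    (hdg : dg.1 = !![lam, 0; 0, mu]) (z : ℍ) : ((dg • z : ℍ) : ℂ) = lam ^ 2 * z := by
  have hmu0 : (mu : ℂ) ≠ 0 := by
    have : mu ≠ 0 := by rintro h; rw [h] at hlm; simp at hlm
    exact_mod_cast this
  have hlm' : (lam : ℂ) * mu = 1 := by exact_mod_cast hlm
  rw [UpperHalfPlane.coe_specialLinearGroup_apply]
  have e : ∀ i j, dg i j = !![lam, 0; 0, mu] i j := fun i j => congrFun (congrFun hdg i) j
  rw [e, e, e, e]
  simp only [Algebra.algebraMap_self, RingHom.id_apply, Matrix.of_apply, Matrix.cons_val_zero,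
    Matrix.cons_val_one, Complex.ofReal_zero, zero_mul, add_zero, zero_add]
  rw [div_eq_iff hmu0]
  linear_combination (-(lam : ℂ) * z) * hlm'

/-- A hyperbolic element translates its axis along itself. -/
theorem exists_translates_of_two_lt_trace {γ : SL(2, ℝ)} (hγ : 2 < γ.1.trace) :
    ∃ ℓ : ℝ, 0 < ℓ ∧ ∃ c : ℝ → ℍ, Isometry c ∧ ∀ t, c (t + ℓ) = γ • c t := by
  obtain ⟨h, dg, lam, mu, hl1, hlm, hdg, hconj⟩ := exists_conj_diagonal hγ
  have hl0 : 0 < lam := by linarith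
  obtain ⟨c, hc, hci⟩ : ∃ c : ℝ → ℍ, Isometry c ∧ ∀ u, (c u : ℂ) = ⟨0, Real.exp u⟩ :=
    ⟨_, UpperHalfPlane.isometry_vertical_line 0, fun u => rfl⟩
  have hcl : ∀ u, c (u + 2 * Real.log lam) = dg • c u := by
    intro u
    apply UpperHalfPlane.ext
    rw [coe_diagonal_smul hlm hdg, hci, hci]
    have he : Real.exp (u + 2 * Real.log lam) = lam ^ 2 * Real.exp u := by
      rw [Real.exp_add, two_mul, Real.exp_add, Real.exp_log hl0]; ring
    apply Complex.ext
    · simp [pow_two]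
    · simp [he, pow_two]
  refine ⟨2 * Real.log lam, by have := Real.log_pos hl1; linarith, fun u => h • c u, ?_,
    fun u => ?_⟩
  · exact (isometry_smul ℍ h).comp hc
  · change h • c (u + 2 * Real.log lam) = γ • h • c u
    rw [hcl, ← mul_smul, ← mul_smul, hconj]

theorem exists_translates_of_trace {γ : SL(2, ℝ)} (hγ : 4 < γ.1.trace ^ 2) :
    ∃ ℓ : ℝ, 0 < ℓ ∧ ∃ c : ℝ → ℍ, Isometry c ∧ ∀ t, c (t + ℓ) = γ • c t := by
  rcases lt_or_ge 2 γ.1.trace with hpos | hpos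
  · exact exists_translates_of_two_lt_trace hpos
  -- `-γ` acts on the hyperbolic plane as `γ` does.
  · have hneg : (-γ).1.trace = - γ.1.trace := Matrix.trace_neg γ.1
    obtain ⟨ℓ, hℓ, c, hc, h⟩ := exists_translates_of_two_lt_trace (γ := -γ)
      (by rw [hneg]; nlinarith)
    refine ⟨ℓ, hℓ, c, hc, fun t => ?_⟩
    rw [h t]
    have : (-γ).toGL = - γ.toGL := by ext; rfl
    change (-γ).toGL • c t = γ.toGL • c t
    rw [this, UpperHalfPlane.neg_smul]

theorem isClosedGeodesicLength_geodesicLength_of_ne_zero {g : ℕ} {W : FreeGroup (Fin (2 * g))}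
    {A : Fin (2 * g) → SL(2, ℝ)} (h : geodesicLength W A ≠ 0) :
    IsClosedGeodesicLength W A (geodesicLength W A) := by
  by_cases hex : ∃ ℓ, IsClosedGeodesicLength W A ℓ
  · obtain ⟨ℓ, hℓ⟩ := hex
    rwa [hℓ.eq]
  · exfalso
    apply h
    have : {ℓ : ℝ | IsClosedGeodesicLength W A ℓ} = ∅ := by
      ext x; simp only [Set.mem_ofPred_eq, Set.mem_empty_iff_false, iff_false]
      exact fun hx => hex ⟨x, hx⟩
    rw [geodesicLength, this, Real.sInf_empty]

theorem geodesicLength_nonneg {g : ℕ} (W : FreeGroup (Fin (2 * g))) (A : Fin (2 * g) → SL(2, ℝ)) :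
    0 ≤ geodesicLength W A := Real.sInf_nonneg fun _ hx => hx.1

/-- The length of a closed geodesic in terms of the trace. -/
theorem cosh_geodesicLength {g : ℕ} (W : FreeGroup (Fin (2 * g))) (A : Fin (2 * g) → SL(2, ℝ)) :
    Real.cosh (geodesicLength W A) = max 1 ((evalWord A W).1.trace ^ 2 / 2 - 1) := by
  by_cases ht : 4 < (evalWord A W).1.trace ^ 2
  · obtain ⟨ℓ, hℓ, c, hc, h⟩ := exists_translates_of_trace ht
    have : IsClosedGeodesicLength W A ℓ := ⟨hℓ.le, c, hc, h⟩
    rw [this.eq, trace_sq_of_translates hℓ hc h, max_eq_right]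
    · ring
    · have := Real.one_le_cosh ℓ; linarith
  -- Elliptic and parabolic elements and `±1`: a positive translation length would force the squared
  -- trace above 4.
  · have h0 : geodesicLength W A = 0 := by
      by_contra hne
      have hpos := (geodesicLength_nonneg W A).lt_of_ne' hne
      obtain ⟨-, c, hc, h⟩ := isClosedGeodesicLength_geodesicLength_of_ne_zero hne
      have := trace_sq_of_translates hpos hc h
      have := Real.one_lt_cosh.mpr hne
      linarith
    rw [h0, Real.cosh_zero, max_eq_left]
    linarith

/-! ### Calculus of parameters: number of reals used and degree of the polynomials -/

/-- `r` is the value at the elements of `S` of an integer polynomial of total degree at most `d`. -/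
def PolyValue (S : Finset ℝ) (d : ℕ) (r : ℝ) : Prop :=
  ∃ p : MvPolynomial ℝ ℤ, p.vars ⊆ S ∧ p.totalDegree ≤ d ∧ MvPolynomial.aeval id p = r

namespace PolyValue

variable {S T : Finset ℝ} {d e : ℕ} {r s : ℝ}

theorem mono (h : PolyValue S d r) (hST : S ⊆ T) (hde : d ≤ e) : PolyValue T e r := by
  obtain ⟨p, h1, h2, h3⟩ := h
  exact ⟨p, h1.trans hST, h2.trans hde, h3⟩

theorem intCast (n : ℤ) : PolyValue S d n :=
  ⟨MvPolynomial.C n, by rw [MvPolynomial.vars_C]; simp,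
    by rw [MvPolynomial.totalDegree_C]; omega, by rw [MvPolynomial.aeval_C]; simp⟩

theorem zero : PolyValue S d 0 := by simpa using intCast (S := S) (d := d) 0

theorem one : PolyValue S d 1 := by simpa using intCast (S := S) (d := d) 1

theorem of_mem (h : r ∈ S) : PolyValue S 1 r :=
  ⟨MvPolynomial.X r, by simpa using h, by simp, by simp⟩

theorem add (hr : PolyValue S d r) (hs : PolyValue S d s) : PolyValue S d (r + s) := by
  obtain ⟨p, h1, h2, rfl⟩ := hr
  obtain ⟨q, h1', h2', rfl⟩ := hs
  exact ⟨p + q, (MvPolynomial.vars_add_subset p q).trans (Finset.union_subset h1 h1'),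
    (MvPolynomial.totalDegree_add p q).trans (max_le h2 h2'), map_add _ _ _⟩

theorem mul (hr : PolyValue S d r) (hs : PolyValue S e s) : PolyValue S (d + e) (r * s) := by
  obtain ⟨p, h1, h2, rfl⟩ := hr
  obtain ⟨q, h1', h2', rfl⟩ := hs
  exact ⟨p * q, (MvPolynomial.vars_mul p q).trans (Finset.union_subset h1 h1'),
    (MvPolynomial.totalDegree_mul p q).trans (add_le_add h2 h2'), map_mul _ _ _⟩

theorem neg (hr : PolyValue S d r) : PolyValue S d (-r) := by
  have := (intCast (S := S) (d := 0) (-1)).mul hr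
  simpa using this

theorem sub (hr : PolyValue S d r) (hs : PolyValue S d s) : PolyValue S d (r - s) := by
  rw [sub_eq_add_neg]; exact hr.add hs.neg

theorem sum {ι : Type*} (t : Finset ι) (f : ι → ℝ) (h : ∀ i ∈ t, PolyValue S d (f i)) :
    PolyValue S d (∑ i ∈ t, f i) := by
  classical
  induction t using Finset.induction_on with
  | empty => simpa using zero
  | insert a t ha ih =>
    rw [Finset.sum_insert ha]
    exact (h a (Finset.mem_insert_self _ _)).add
      (ih fun i hi => h i (Finset.mem_insert_of_mem hi))

/-- Values at at most `N` reals are values of polynomials in `N` variables. -/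
theorem exists_fin {N : ℕ} (hN : 0 < N) (hS : S.card ≤ N) :
    ∃ x : Fin N → ℝ, ∀ d r, PolyValue S d r →
      ∃ p : MvPolynomial (Fin N) ℤ, p.totalDegree ≤ d ∧ MvPolynomial.aeval x p = r := by
  classical
  -- Dummy parameters pad `S` to exactly `N` elements.
  obtain ⟨T, hST, hT⟩ := Infinite.exists_superset_card_eq S N hS
  let f := T.equivFinOfCardEq hT
  refine ⟨fun i => f.symm i, fun d r hr => ?_⟩
  obtain ⟨p, h1, h2, rfl⟩ := hr
  let φ : ℝ → Fin N := fun r => if h : r ∈ T then f ⟨r, h⟩ else ⟨0, hN⟩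
  refine ⟨MvPolynomial.rename φ p, (MvPolynomial.totalDegree_rename_le φ p).trans h2, ?_⟩
  rw [MvPolynomial.aeval_rename]
  refine MvPolynomial.eval₂Hom_congr' rfl (fun i hi _ => ?_) rfl
  have hi' : i ∈ T := hST (h1 hi)
  simp [φ, hi']

end PolyValue

/-- All entries of `M` are values of integer polynomials of degree at most `d`. -/
def MatPolyValue (S : Finset ℝ) (d : ℕ) (M : Matrix (Fin 2) (Fin 2) ℝ) : Prop :=
  ∀ i j, PolyValue S d (M i j)

namespace MatPolyValue

variable {S T : Finset ℝ} {d e : ℕ} {M N : Matrix (Fin 2) (Fin 2) ℝ} {r : ℝ}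

theorem mono (h : MatPolyValue S d M) (hST : S ⊆ T) (hde : d ≤ e) : MatPolyValue T e M :=
  fun i j => (h i j).mono hST hde

theorem sub (hM : MatPolyValue S d M) (hN : MatPolyValue S d N) : MatPolyValue S d (M - N) :=
  fun i j => (hM i j).sub (hN i j)

theorem mul (hM : MatPolyValue S d M) (hN : MatPolyValue S e N) :
    MatPolyValue S (d + e) (M * N) := by
  intro i j
  rw [Matrix.mul_apply]
  exact PolyValue.sum _ _ fun k _ => (hM i k).mul (hN k j)

theorem smul (hr : PolyValue S d r) (hM : MatPolyValue S e M) : MatPolyValue S (d + e) (r • M) :=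
  fun i j => hr.mul (hM i j)

theorem one : MatPolyValue S d 1 := by
  intro i j
  rw [Matrix.one_apply]
  split_ifs
  · exact PolyValue.one
  · exact PolyValue.zero

theorem adjugate (hM : MatPolyValue S d M) : MatPolyValue S d M.adjugate := by
  intro i j
  rw [Matrix.adjugate_fin_two]
  fin_cases i <;> fin_cases j <;> simp
  · exact hM 1 1
  · exact (hM 0 1).neg
  · exact (hM 1 0).neg
  · exact hM 0 0

theorem det (hM : MatPolyValue S d M) : PolyValue S (d + d) M.det := by
  rw [Matrix.det_fin_two]
  exact ((hM 0 0).mul (hM 1 1)).sub ((hM 0 1).mul (hM 1 0))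

end MatPolyValue

/-- A nonzero multiple of `M` has entries which are values of integer polynomials. -/
def ProjPolyValue (S : Finset ℝ) (d : ℕ) (M : Matrix (Fin 2) (Fin 2) ℝ) : Prop :=
  ∃ c : ℝ, c ≠ 0 ∧ MatPolyValue S d (c • M)

/-- `M` is a quotient of a matrix and of a number given by values of integer polynomials. -/
def FracPolyValue (S : Finset ℝ) (d : ℕ) (M : Matrix (Fin 2) (Fin 2) ℝ) : Prop :=
  ∃ c : ℝ, c ≠ 0 ∧ PolyValue S d c ∧ MatPolyValue S d (c • M)

theorem ProjPolyValue.mono {S T : Finset ℝ} {d e : ℕ} {M : Matrix (Fin 2) (Fin 2) ℝ}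
    (h : ProjPolyValue S d M) (hST : S ⊆ T) (hde : d ≤ e) : ProjPolyValue T e M := by
  obtain ⟨c, hc, h⟩ := h
  exact ⟨c, hc, h.mono hST hde⟩

namespace FracPolyValue

variable {S T : Finset ℝ} {d e : ℕ} {M N : Matrix (Fin 2) (Fin 2) ℝ}

theorem mono (h : FracPolyValue S d M) (hST : S ⊆ T) (hde : d ≤ e) : FracPolyValue T e M := by
  obtain ⟨c, hc, h1, h2⟩ := h
  exact ⟨c, hc, h1.mono hST hde, h2.mono hST hde⟩

theorem one : FracPolyValue S d 1 :=
  ⟨1, one_ne_zero, PolyValue.one, by rw [one_smul]; exact MatPolyValue.one⟩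

theorem mul (hM : FracPolyValue S d M) (hN : FracPolyValue S e N) :
    FracPolyValue S (d + e) (M * N) := by
  obtain ⟨a, ha, h1, h2⟩ := hM
  obtain ⟨b, hb, h3, h4⟩ := hN
  exact ⟨a * b, mul_ne_zero ha hb, h1.mul h3, by rw [← smul_mul_smul_comm]; exact h2.mul h4⟩

theorem neg (hM : FracPolyValue S d M) : FracPolyValue S d (-M) := by
  obtain ⟨a, ha, h1, h2⟩ := hM
  exact ⟨-a, neg_ne_zero.mpr ha, h1.neg, by rwa [neg_smul_neg]⟩

theorem inv {γ : SL(2, ℝ)} (h : FracPolyValue S d γ.1) : FracPolyValue S d (γ⁻¹).1 := by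
  obtain ⟨a, ha, h1, h2⟩ := h
  refine ⟨a, ha, h1, ?_⟩
  have := h2.adjugate
  rw [Matrix.adjugate_smul] at this
  simpa using this

end FracPolyValue

/-- Commutators do not see scaling, so projective data suffice. The squares of the unknown scaling
factors are determinants of the scaled matrices, hence polynomial values, and serve as denominator.
-/
theorem FracPolyValue.commutator {S : Finset ℝ} {d : ℕ} {a b : SL(2, ℝ)}
    (ha : ProjPolyValue S d a.1) (hb : ProjPolyValue S d b.1) :
    FracPolyValue S (4 * d) (a * b * a⁻¹ * b⁻¹).1 := by
  obtain ⟨s, hs, h1⟩ := ha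
  obtain ⟨t, ht, h2⟩ := hb
  have e1 : s ^ 2 = (s • a.1).det := by
    have : a.1.det = 1 := a.2
    rw [Matrix.det_smul, this]; simp
  have e2 : t ^ 2 = (t • b.1).det := by
    have : b.1.det = 1 := b.2
    rw [Matrix.det_smul, this]; simp
  refine ⟨s ^ 2 * t ^ 2, by positivity, ?_, ?_⟩
  · rw [e1, e2]
    exact (h1.det.mul h2.det).mono subset_rfl (by omega)
  · have h3 := h1.adjugate
    have h4 := h2.adjugate
    rw [Matrix.adjugate_smul] at h3 h4
    have := ((h1.mul h2).mul h3).mul h4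
    have e : (s ^ 2 * t ^ 2) • (a * b * a⁻¹ * b⁻¹).1 =
        s • a.1 * t • b.1 * s ^ (Fintype.card (Fin 2) - 1) • a.1.adjugate *
          t ^ (Fintype.card (Fin 2) - 1) • b.1.adjugate := by
      have : (a * b * a⁻¹ * b⁻¹).1 = a.1 * b.1 * a.1.adjugate * b.1.adjugate := rfl
      rw [this]
      simp only [Fintype.card_fin, Matrix.smul_mul, Matrix.mul_smul, smul_smul]
      congr 1
      simp; ring
    rw [e]
    exact this.mono subset_rfl (by omega)

theorem FracPolyValue.list_prod {S : Finset ℝ} {d : ℕ} (l : List SL(2, ℝ))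
    (h : ∀ a ∈ l, FracPolyValue S d a.1) : FracPolyValue S (d * l.length) l.prod.1 := by
  induction l with
  | nil => exact FracPolyValue.one
  | cons a l ih =>
    have h1 := h a (by simp)
    have h2 := ih fun b hb => h b (by simp [hb])
    have := h1.mul h2
    rw [List.prod_cons, List.length_cons]
    exact this.mono subset_rfl (by rw [mul_add]; omega)

/-! ### Parameters for matrices and for the equation `C X Y = Y X` -/

/-- A solution `Y` of `P Y = Y Q` is described by one parameter. -/
theorem exists_projPolyValue_intertwiner {S : Finset ℝ} {e : ℕ} {P Q Y : Matrix (Fin 2) (Fin 2) ℝ}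
    (hP : MatPolyValue S e P) (hQ : MatPolyValue S e Q) (hY : Y.det ≠ 0) (h : P * Y = Y * Q)
    (hQs : ∀ a : ℝ, Q ≠ a • 1) : ∃ y, ProjPolyValue (insert y S) (e + 1) Y := by
  obtain ⟨l0, l1, hl⟩ : ∃ l0 l1 : ℤ,
      -- Up to sign this is the determinant of the rows `l` and `l Q`. As `Q` is not scalar, `l` can
      -- be taken among `(1,0)`, `(0,1)`, `(1,1)`.
      (l1 * (l0 * Q 0 0 + l1 * Q 1 0) - l0 * (l0 * Q 0 1 + l1 * Q 1 1) : ℝ) ≠ 0 := by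
    by_contra hcon
    push Not at hcon
    have h1 := hcon 1 0
    have h2 := hcon 0 1
    have h3 := hcon 1 1
    norm_num at h1 h2 h3
    apply hQs (Q 0 0)
    ext i j
    fin_cases i <;> fin_cases j <;> simp
    · exact h1
    · exact h2
    · linarith
  set c : ℝ := l1 * (l0 * Q 0 0 + l1 * Q 1 0) - l0 * (l0 * Q 0 1 + l1 * Q 1 1) with hc
  set T : Matrix (Fin 2) (Fin 2) ℝ := !![l1 * l0, l1 * l1; -l0 * l0, -l0 * l1] with hT
  -- `T` is the column `(l1, -l0)` times the row `l`. Multiplying by `Y` recovers `c • Y` from `Y *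
  -- T`, hence from the vector `w = Y (l1, -l0)`. Up to scaling `w` is the single number `w1 / w0`,
  -- or the vector `(0, 1)` when `w0 = 0`.
  have hid : Q * T - T * Q.adjugate = c • 1 := by
    ext i j
    rw [Matrix.adjugate_fin_two]
    fin_cases i <;> fin_cases j <;>
      simp [hT, hc, Matrix.mul_apply, Fin.sum_univ_two] <;> ring
  have hYT : P * (Y * T) - Y * T * Q.adjugate = c • Y := by
    rw [← mul_assoc, h, mul_assoc, mul_assoc, ← mul_sub, hid]; simp
  have hl01 : (l0 : ℝ) ≠ 0 ∨ (l1 : ℝ) ≠ 0 := by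
    by_contra hcon
    push Not at hcon
    apply hl
    rw [hc, hcon.1, hcon.2]; ring
  obtain ⟨w0, hw0⟩ : ∃ w, w = Y 0 0 * l1 - Y 0 1 * l0 := ⟨_, rfl⟩
  obtain ⟨w1, hw1⟩ : ∃ w, w = Y 1 0 * l1 - Y 1 1 * l0 := ⟨_, rfl⟩
  have hYT' : Y * T = !![w0 * l0, w0 * l1; w1 * l0, w1 * l1] := by
    ext i j
    fin_cases i <;> fin_cases j <;>
      simp [hT, Matrix.mul_apply, Fin.sum_univ_two, hw0, hw1] <;> ring
  have fin : ∀ (ρ y : ℝ) (W : Matrix (Fin 2) (Fin 2) ℝ), ρ ≠ 0 → Y * T = ρ • W →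
      MatPolyValue (insert y S) 1 W → ProjPolyValue (insert y S) (e + 1) Y := by
    intro ρ y W hρ hW hWm
    refine ⟨ρ⁻¹ * c, mul_ne_zero (inv_ne_zero hρ) hl, ?_⟩
    rw [mul_smul, ← hYT, hW]
    have e1 : ρ⁻¹ • (P * ρ • W - ρ • W * Q.adjugate) = P * W - W * Q.adjugate := by
      rw [Matrix.mul_smul, Matrix.smul_mul, ← smul_sub, smul_smul, inv_mul_cancel₀ hρ, one_smul]
    rw [e1]
    have hP' := hP.mono (Finset.subset_insert y S) le_rfl
    have hQ' := hQ.adjugate.mono (Finset.subset_insert y S) le_rfl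
    exact (hP'.mul hWm).sub ((hWm.mul hQ').mono subset_rfl (by omega))
  rcases eq_or_ne w0 0 with h0 | h0
  · have h1 : w1 ≠ 0 := by
      intro h1
      apply hY
      rw [Matrix.det_fin_two]
      rcases hl01 with hl0 | hl1
      · apply mul_right_cancel₀ hl0
        rw [zero_mul]
        linear_combination (Y 1 0) * (hw0.symm.trans h0) - (Y 0 0) * (hw1.symm.trans h1)
      · apply mul_right_cancel₀ hl1
        rw [zero_mul]
        linear_combination (Y 1 1) * (hw0.symm.trans h0) - (Y 0 1) * (hw1.symm.trans h1)
    refine ⟨0, fin w1 0 !![0, 0; (l0 : ℝ), l1] h1 ?_ ?_⟩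
    · rw [hYT', h0]
      ext i j
      fin_cases i <;> fin_cases j <;> simp
    · intro i j
      fin_cases i <;> fin_cases j <;> simp
      · exact PolyValue.zero
      · exact PolyValue.zero
      · exact PolyValue.intCast l0
      · exact PolyValue.intCast l1
  · have hy : PolyValue (insert (w1 / w0) S) 1 (w1 / w0) :=
      PolyValue.of_mem (Finset.mem_insert_self _ _)
    refine ⟨w1 / w0, fin w0 _ !![(l0 : ℝ), l1; (w1 / w0) * l0, (w1 / w0) * l1] h0 ?_ ?_⟩
    · rw [hYT']
      ext i j
      fin_cases i <;> fin_cases j <;> simp <;> field_simp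
    · intro i j
      fin_cases i <;> fin_cases j <;> simp
      · exact PolyValue.intCast l0
      · exact PolyValue.intCast l1
      · exact hy.mul (PolyValue.intCast (d := 0) l0)
      · exact hy.mul (PolyValue.intCast (d := 0) l1)

/-- A nonzero matrix is described up to scaling by three parameters. -/
theorem exists_projPolyValue_of_ne_zero (S : Finset ℝ) {X : Matrix (Fin 2) (Fin 2) ℝ}
    (hX : X ≠ 0) : ∃ T, S ⊆ T ∧ T.card ≤ S.card + 3 ∧ ProjPolyValue T 1 X := by
  classical
  obtain ⟨p, hp⟩ : ∃ p : Fin 2 × Fin 2, X p.1 p.2 ≠ 0 := by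
    by_contra hcon
    push Not at hcon
    exact hX (by ext i j; exact hcon (i, j))
  set R := (Finset.univ.erase p).image fun q : Fin 2 × Fin 2 => (X p.1 p.2)⁻¹ * X q.1 q.2 with hR
  have hRc : R.card ≤ 3 := Finset.card_image_le.trans (by
    rw [Finset.card_erase_of_mem (Finset.mem_univ p)]; simp)
  refine ⟨S ∪ R, Finset.subset_union_left, (Finset.card_union_le _ _).trans (by omega),
    (X p.1 p.2)⁻¹, inv_ne_zero hp, fun i j => ?_⟩
  rw [Matrix.smul_apply, smul_eq_mul]
  by_cases h : (i, j) = p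
  · rw [← h, inv_mul_cancel₀ (by rw [← h] at hp; exact hp)]
    exact PolyValue.one
  · exact PolyValue.of_mem (Finset.mem_union_right _
      (Finset.mem_image.mpr ⟨(i, j), Finset.mem_erase.mpr ⟨h, Finset.mem_univ _⟩, rfl⟩))

/-- The matrices orthogonal to a nonzero matrix `m` for the trace form are described up to scaling
by two parameters. -/
theorem exists_projPolyValue_of_trace_mul_eq_zero {S : Finset ℝ} {e : ℕ}
    {m X : Matrix (Fin 2) (Fin 2) ℝ} (hm : MatPolyValue S e m) (hm0 : m ≠ 0) (hX : X ≠ 0)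
    (h : (m * X).trace = 0) :
    ∃ T, S ⊆ T ∧ T.card ≤ S.card + 2 ∧ ProjPolyValue T (e + 1) X := by
  classical
  obtain ⟨o, ho⟩ : ∃ o : Fin 2 × Fin 2, m o.2 o.1 ≠ 0 := by
    by_contra hcon
    push Not at hcon
    exact hm0 (by ext i j; exact hcon (j, i))
  have hsum : ∑ q : Fin 2 × Fin 2, m q.2 q.1 * X q.1 q.2 = 0 := by
    rw [← h, Matrix.trace, Fintype.sum_prod_type, Finset.sum_comm]
    simp [Matrix.mul_apply]
  rw [← Finset.add_sum_erase _ _ (Finset.mem_univ o)] at hsum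
  -- Entry `o` is solved for from the linear relation and entry `p` is scaled to 1, leaving two
  -- ratios. The final scaling also multiplies by the coefficient of `o`, which avoids a division
  -- and costs degree `e`.
  obtain ⟨p, hpo, hp⟩ : ∃ p : Fin 2 × Fin 2, p ≠ o ∧ X p.1 p.2 ≠ 0 := by
    by_contra hcon
    push Not at hcon
    have h0 : m o.2 o.1 * X o.1 o.2 = 0 := by
      rw [Finset.sum_eq_zero, add_zero] at hsum
      · exact hsum
      · intro q hq
        rw [hcon q (Finset.ne_of_mem_erase hq), mul_zero]
    apply hX
    ext i j
    by_cases hij : (i, j) = o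
    · rw [← hij] at h0
      rw [← hij] at ho
      exact (mul_eq_zero.mp h0).resolve_left ho
    · exact hcon (i, j) hij
  set R := ((Finset.univ.erase o).erase p).image
    fun q : Fin 2 × Fin 2 => (X p.1 p.2)⁻¹ * X q.1 q.2 with hR
  have hRc : R.card ≤ 2 := Finset.card_image_le.trans (by
    rw [Finset.card_erase_of_mem (Finset.mem_erase.mpr ⟨hpo, Finset.mem_univ p⟩),
      Finset.card_erase_of_mem (Finset.mem_univ o)]; simp)
  have hent : ∀ q : Fin 2 × Fin 2, q ≠ o → PolyValue (S ∪ R) 1 ((X p.1 p.2)⁻¹ * X q.1 q.2) := by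
    intro q hq
    by_cases hqp : q = p
    · rw [hqp, inv_mul_cancel₀ hp]; exact PolyValue.one
    · exact PolyValue.of_mem (Finset.mem_union_right _ (Finset.mem_image.mpr
        ⟨q, Finset.mem_erase.mpr ⟨hqp, Finset.mem_erase.mpr ⟨hq, Finset.mem_univ _⟩⟩, rfl⟩))
  have hm' := hm.mono (Finset.subset_union_left (s₁ := S) (s₂ := R)) le_rfl
  refine ⟨S ∪ R, Finset.subset_union_left, (Finset.card_union_le _ _).trans (by omega),
    m o.2 o.1 * (X p.1 p.2)⁻¹, mul_ne_zero ho (inv_ne_zero hp), fun i j => ?_⟩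
  rw [Matrix.smul_apply, smul_eq_mul]
  by_cases hij : (i, j) = o
  · have e1 : m o.2 o.1 * (X p.1 p.2)⁻¹ * X i j =
        -∑ q ∈ Finset.univ.erase o, m q.2 q.1 * ((X p.1 p.2)⁻¹ * X q.1 q.2) := by
      rw [← hij] at hsum ⊢
      have e2 : ∑ q ∈ Finset.univ.erase (i, j), m q.2 q.1 * ((X p.1 p.2)⁻¹ * X q.1 q.2) =
          (X p.1 p.2)⁻¹ * ∑ q ∈ Finset.univ.erase (i, j), m q.2 q.1 * X q.1 q.2 := by
        rw [Finset.mul_sum]; exact Finset.sum_congr rfl fun q _ => by ring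
      rw [e2]
      linear_combination (X p.1 p.2)⁻¹ * hsum
    rw [e1]
    exact (PolyValue.sum _ _ fun q hq =>
      (hm' q.2 q.1).mul (hent q (Finset.ne_of_mem_erase hq))).neg
  · rw [mul_assoc]
    exact (hm' o.2 o.1).mul (hent (i, j) hij)

theorem Matrix.SpecialLinearGroup.val_ne_zero (X : SL(2, ℝ)) : X.1 ≠ 0 := by
  intro h
  have := X.2
  rw [h] at this
  simp at this

/-- Solutions of `C X Y = Y X` with given `C ≠ 1` are described by three parameters. -/
theorem exists_projPolyValue_pair {S : Finset ℝ} {e : ℕ} {C X Y : SL(2, ℝ)}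
    (hC : FracPolyValue S e C.1) (hC1 : C ≠ 1) (h : C * X * Y = Y * X) :
    ∃ T, S ⊆ T ∧ T.card ≤ S.card + 3 ∧ ProjPolyValue T (e + 1) X.1 ∧
      ProjPolyValue T (2 * e + 2) Y.1 := by
  obtain ⟨D, hD, hDp, hCp⟩ := hC
  have hm : MatPolyValue S e (D • C.1 - D • 1) := by
    refine hCp.sub ?_
    have := MatPolyValue.smul hDp (MatPolyValue.one (d := 0))
    exact this
  have hm0 : D • C.1 - D • (1 : Matrix (Fin 2) (Fin 2) ℝ) ≠ 0 := by
    rw [← smul_sub]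
    intro h0
    have := (smul_eq_zero.mp h0).resolve_left hD
    exact hC1 (Subtype.ext (sub_eq_zero.mp this))
  -- `C * X` is conjugate to `X` by `Y`, so their traces agree. This linear condition on `X` saves
  -- one parameter: two remain for `X` and one for `Y`.
  have htr : ((D • C.1 - D • 1) * X.1).trace = 0 := by
    have h1 : C * X = Y * X * Y⁻¹ := by rw [← h]; group
    have h2 : (C.1 * X.1).trace = X.1.trace := by
      have h3 := Matrix.SpecialLinearGroup.trace_conj_eq Y⁻¹ X
      rw [inv_inv, ← h1] at h3
      exact h3
    rw [sub_mul, Matrix.smul_mul, Matrix.smul_mul, one_mul, Matrix.trace_sub, Matrix.trace_smul,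
      Matrix.trace_smul, h2, sub_self]
  obtain ⟨T, hST, hT, c, hc, hX⟩ :=
    exists_projPolyValue_of_trace_mul_eq_zero hm hm0 X.val_ne_zero htr
  have hP := (hCp.mono hST le_rfl).mul hX
  have hQ := MatPolyValue.smul (hDp.mono hST le_rfl) hX
  have hint : (D • C.1) * (c • X.1) * Y.1 = Y.1 * (D • c • X.1) := by
    have := congrArg Subtype.val h
    change C.1 * X.1 * Y.1 = Y.1 * X.1 at this
    simp only [Matrix.smul_mul, Matrix.mul_smul, this, smul_smul, mul_comm c D]
  have hQs : ∀ a : ℝ, D • c • X.1 ≠ a • 1 := by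
    intro a ha
    apply hC1
    have hXs : X.1 = ((D * c)⁻¹ * a) • 1 := by
      rw [mul_smul, ← ha, smul_smul D, smul_smul, inv_mul_cancel₀ (mul_ne_zero hD hc), one_smul]
    have hcomm : Y * X = X * Y := by
      apply Subtype.ext
      change Y.1 * X.1 = X.1 * Y.1
      rw [hXs]; simp
    have : C * (X * Y) = 1 * (X * Y) := by rw [← mul_assoc, h, hcomm, one_mul]
    exact mul_right_cancel this
  obtain ⟨y, hY⟩ := exists_projPolyValue_intertwiner hP hQ
    (by have := Y.2; rw [this]; exact one_ne_zero) hint hQs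
  refine ⟨insert y T, hST.trans (Finset.subset_insert _ _),
    (Finset.card_insert_le _ _).trans (by omega),
    ProjPolyValue.mono ⟨c, hc, hX⟩ (Finset.subset_insert _ _) le_rfl,
    hY.mono subset_rfl (by omega)⟩

/-- Solutions of `C X Y = Y X` with given `C` are described by four parameters. -/
theorem exists_projPolyValue_pair' {S : Finset ℝ} {e : ℕ} {C X Y : SL(2, ℝ)}
    (hC : FracPolyValue S e C.1) (h : C * X * Y = Y * X) :
    ∃ T, S ⊆ T ∧ T.card ≤ S.card + 4 ∧ ProjPolyValue T (e + 2) X.1 ∧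
      ProjPolyValue T (e + 2) Y.1 := by
  -- A scalar `X` needs no parameter and leaves three for `Y`. Otherwise `X` takes three and `Y`, as
  -- an intertwiner, one.
  by_cases hXs : ∃ a : ℝ, X.1 = a • 1
  · obtain ⟨a, ha⟩ := hXs
    have ha0 : a ≠ 0 := by
      rintro rfl
      exact X.val_ne_zero (by rw [ha, zero_smul])
    obtain ⟨T, hST, hT, hY⟩ := exists_projPolyValue_of_ne_zero S Y.val_ne_zero
    refine ⟨T, hST, by omega, ⟨a⁻¹, inv_ne_zero ha0, ?_⟩, hY.mono subset_rfl (by omega)⟩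
    rw [ha, smul_smul, inv_mul_cancel₀ ha0, one_smul]
    exact MatPolyValue.one
  · push Not at hXs
    obtain ⟨D, hD, hDp, hCp⟩ := hC
    obtain ⟨T, hST, hT, c, hc, hX⟩ := exists_projPolyValue_of_ne_zero S X.val_ne_zero
    have hP := (hCp.mono hST le_rfl).mul hX
    have hQ := MatPolyValue.smul (hDp.mono hST le_rfl) hX
    have hint : (D • C.1) * (c • X.1) * Y.1 = Y.1 * (D • c • X.1) := by
      have := congrArg Subtype.val h
      change C.1 * X.1 * Y.1 = Y.1 * X.1 at this
      simp only [Matrix.smul_mul, Matrix.mul_smul, this, smul_smul, mul_comm c D]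
    have hQs : ∀ a : ℝ, D • c • X.1 ≠ a • 1 := by
      intro a ha
      apply hXs ((D * c)⁻¹ * a)
      rw [mul_smul, ← ha, smul_smul D, smul_smul, inv_mul_cancel₀ (mul_ne_zero hD hc), one_smul]
    obtain ⟨y, hY⟩ := exists_projPolyValue_intertwiner hP hQ
      (by have := Y.2; rw [this]; exact one_ne_zero) hint hQs
    refine ⟨insert y T, hST.trans (Finset.subset_insert _ _),
      (Finset.card_insert_le _ _).trans (by omega),
      ProjPolyValue.mono ⟨c, hc, hX⟩ (Finset.subset_insert _ _) (by omega),
      hY.mono subset_rfl (by omega)⟩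

theorem exists_projPolyValue_family (S : Finset ℝ) {ι : Type*} (t : Finset ι) (E : ι → SL(2, ℝ)) :
    ∃ T, S ⊆ T ∧ T.card ≤ S.card + 3 * t.card ∧ ∀ i ∈ t, ProjPolyValue T 1 (E i).1 := by
  classical
  induction t using Finset.induction_on with
  | empty => exact ⟨S, subset_rfl, by simp, by simp⟩
  | insert a t ha ih =>
    obtain ⟨T, h1, h2, h3⟩ := ih
    obtain ⟨T', h4, h5, h6⟩ := exists_projPolyValue_of_ne_zero T (E a).val_ne_zero
    refine ⟨T', h1.trans h4, ?_, fun i hi => ?_⟩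
    · rw [Finset.card_insert_of_notMem ha]; omega
    · rcases Finset.mem_insert.mp hi with rfl | hi
      · exact h6
      · exact (h3 i hi).mono h4 le_rfl

/-! ### Parameters for the surface relation -/

section tuples

variable {k : ℕ}

/-- The product of all but the first two commutators. -/
def tailCommutatorProduct {G : Type*} [Group G] (A : Fin (2 * (k + 2)) → G) : G :=
  (List.ofFn fun i : Fin k =>
    let a := A ⟨2 * ((i : ℕ) + 2), by omega⟩
    let b := A ⟨2 * ((i : ℕ) + 2) + 1, by omega⟩
    a * b * a⁻¹ * b⁻¹).prod

theorem commutatorProduct_eq {G : Type*} [Group G] (A : Fin (2 * (k + 2)) → G) :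
    commutatorProduct A =
      (A ⟨0, by omega⟩ * A ⟨1, by omega⟩ * (A ⟨0, by omega⟩)⁻¹ * (A ⟨1, by omega⟩)⁻¹) *
      ((A ⟨2, by omega⟩ * A ⟨3, by omega⟩ * (A ⟨2, by omega⟩)⁻¹ * (A ⟨3, by omega⟩)⁻¹) *
        tailCommutatorProduct A) := by
  rw [commutatorProduct, List.ofFn_succ, List.prod_cons, List.ofFn_succ, List.prod_cons]
  rfl

theorem map_commutatorProduct {G H : Type*} [Group G] [Group H] {g : ℕ} (φ : G →* H)
    (A : Fin (2 * g) → G) : commutatorProduct (fun i => φ (A i)) = φ (commutatorProduct A) := by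
  rw [commutatorProduct, commutatorProduct, map_list_prod, List.map_ofFn]
  congr 2
  funext i
  simp

/-- The indices from `4` on. -/
def tailIndices (k : ℕ) : Finset (Fin (2 * (k + 2))) := Finset.univ.filter fun i => 4 ≤ i.1

theorem card_tailIndices : (tailIndices k).card ≤ 2 * k := by
  have hinj : Set.InjOn (fun i : Fin (2 * (k + 2)) => i.1 - 4) (tailIndices k) := by
    intro i hi j hj hij
    simp only [tailIndices, Finset.coe_filter, Finset.mem_univ, true_and, Set.mem_ofPred_eq]
      at hi hj
    apply Fin.ext
    simp only at hij
    omega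
  rw [← Finset.card_image_of_injOn hinj]
  refine (Finset.card_le_card (t := Finset.range (2 * k)) ?_).trans (by simp)
  intro x hx
  obtain ⟨i, hi, rfl⟩ := Finset.mem_image.mp hx
  have := i.2
  simp only [tailIndices, Finset.mem_filter, Finset.mem_univ, true_and] at hi
  rw [Finset.mem_range]
  omega

theorem fracPolyValue_tailCommutatorProduct {S : Finset ℝ} {A : Fin (2 * (k + 2)) → SL(2, ℝ)}
    (h : ∀ i ∈ tailIndices k, ProjPolyValue S 1 (A i).1) :
    FracPolyValue S (4 * k) (tailCommutatorProduct A).1 := by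
  have := FracPolyValue.list_prod (S := S) (d := 4) (List.ofFn fun i : Fin k =>
    A ⟨2 * ((i : ℕ) + 2), by omega⟩ * A ⟨2 * ((i : ℕ) + 2) + 1, by omega⟩ *
      (A ⟨2 * ((i : ℕ) + 2), by omega⟩)⁻¹ * (A ⟨2 * ((i : ℕ) + 2) + 1, by omega⟩)⁻¹) (by
    intro a ha
    obtain ⟨i, rfl⟩ := (List.mem_ofFn' _ _).mp ha
    exact FracPolyValue.commutator (d := 1) (h _ (by simp [tailIndices]; omega))
      (h _ (by simp [tailIndices]; omega)))
  rw [List.length_ofFn] at this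
  exact this

theorem forall_index_of_tail {p : Fin (2 * (k + 2)) → Prop} (h0 : p ⟨0, by omega⟩)
    (h1 : p ⟨1, by omega⟩) (h2 : p ⟨2, by omega⟩) (h3 : p ⟨3, by omega⟩)
    (h : ∀ i ∈ tailIndices k, p i) (i : Fin (2 * (k + 2))) : p i := by
  obtain ⟨i, hi⟩ := i
  match i, hi with
  | 0, _ => exact h0
  | 1, _ => exact h1
  | 2, _ => exact h2
  | 3, _ => exact h3
  | n + 4, hn => exact h _ (by simp [tailIndices])

/-- Tuples of the surface relation whose first two commutators are determined by the product of
the others depend on few parameters. -/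
theorem exists_projPolyValue_degenerate {A : Fin (2 * (k + 2)) → SL(2, ℝ)} {C C₁ : SL(2, ℝ)}
    (hC : C * A ⟨0, by omega⟩ * A ⟨1, by omega⟩ = A ⟨1, by omega⟩ * A ⟨0, by omega⟩)
    (hC₁ : C₁ * A ⟨2, by omega⟩ * A ⟨3, by omega⟩ = A ⟨3, by omega⟩ * A ⟨2, by omega⟩)
    (hf : ∀ S : Finset ℝ, FracPolyValue S (4 * k) (tailCommutatorProduct A).1 →
      FracPolyValue S (4 * k) C.1 ∧ FracPolyValue S (4 * k) C₁.1) :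
    ∃ S : Finset ℝ, S.card ≤ 6 * k + 8 ∧ ∀ i, ProjPolyValue S (4 * k + 2) (A i).1 := by
  obtain ⟨S, -, hS, hE⟩ := exists_projPolyValue_family ∅ (tailIndices k) A
  have hcard := card_tailIndices (k := k)
  rw [Finset.card_empty] at hS
  obtain ⟨h1, h2⟩ := hf S (fracPolyValue_tailCommutatorProduct hE)
  -- Four parameters for each pair on top of `6 * k` stay one below the dimension `6 * k + 9`, so
  -- the degree is of no importance here.
  obtain ⟨T, hST, hT, hX, hY⟩ := exists_projPolyValue_pair' h1 hC
  obtain ⟨U, hTU, hU, hX', hY'⟩ := exists_projPolyValue_pair' (h2.mono hST le_rfl) hC₁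
  refine ⟨U, by omega, forall_index_of_tail (hX.mono hTU le_rfl) (hY.mono hTU le_rfl) hX' hY' ?_⟩
  intro i hi
  exact (hE i hi).mono (hST.trans hTU) (by omega)

/-- Generic tuples of the surface relation for which the inverse of the first commutator is a
companion matrix. -/
theorem exists_projPolyValue_companion {A : Fin (2 * (k + 2)) → SL(2, ℝ)} {C C₁ : SL(2, ℝ)} {σ : ℝ}
    (hσ : C.1 = !![0, -1; 1, σ])
    (hC : C * A ⟨0, by omega⟩ * A ⟨1, by omega⟩ = A ⟨1, by omega⟩ * A ⟨0, by omega⟩)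
    (hC₁ : C₁ * A ⟨2, by omega⟩ * A ⟨3, by omega⟩ = A ⟨3, by omega⟩ * A ⟨2, by omega⟩)
    (hCC₁ : C₁ = tailCommutatorProduct A * C⁻¹) (hne : C₁ ≠ 1) :
    ∃ S : Finset ℝ, S.card ≤ 6 * k + 7 ∧ ∀ i, ProjPolyValue S (8 * k + 4) (A i).1 := by
  -- The count is `1 + 6 * k + 3 + 3`; the conjugator later adds two. The largest degree is that of
  -- the fourth matrix: `C₁` has degree `4 * k + 1`, which gives `2 * (4 * k + 1) + 2`.
  obtain ⟨S, hσS, hS, hE⟩ := exists_projPolyValue_family {σ} (tailIndices k) A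
  have hcard := card_tailIndices (k := k)
  rw [Finset.card_singleton] at hS
  have hCf : FracPolyValue S 1 C.1 := by
    refine ⟨1, one_ne_zero, PolyValue.one, ?_⟩
    rw [one_smul, hσ]
    intro i j
    fin_cases i <;> fin_cases j <;> simp
    · exact PolyValue.zero
    · exact PolyValue.one.neg
    · exact PolyValue.one
    · exact PolyValue.of_mem (hσS (Finset.mem_singleton_self σ))
  have hC1 : C ≠ 1 := by
    intro h
    have := congrFun (congrFun (hσ.symm.trans (congrArg Subtype.val h)) 0) 0
    simp at this
  have hC₁f : FracPolyValue S (4 * k + 1) C₁.1 := by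
    rw [hCC₁]
    exact (fracPolyValue_tailCommutatorProduct hE).mul hCf.inv
  obtain ⟨T, hST, hT, hX, hY⟩ := exists_projPolyValue_pair hCf hC1 hC
  obtain ⟨U, hTU, hU, hX', hY'⟩ := exists_projPolyValue_pair (hC₁f.mono hST le_rfl) hne hC₁
  refine ⟨U, by omega, forall_index_of_tail (hX.mono hTU (by omega)) (hY.mono hTU (by omega))
    (hX'.mono subset_rfl (by omega)) (hY'.mono subset_rfl (by omega)) ?_⟩
  intro i hi
  exact (hE i hi).mono (hST.trans hTU) (by omega)

end tuples

/-- Conjugation of `SL₂` by an invertible matrix. -/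
noncomputable def conjHom (h : Matrix (Fin 2) (Fin 2) ℝ) (hh : IsUnit h.det) :
    SL(2, ℝ) →* SL(2, ℝ) where
  toFun M := ⟨h⁻¹ * M.1 * h, by
    rw [Matrix.det_mul, Matrix.det_mul, M.2, mul_one, ← Matrix.det_mul,
      Matrix.nonsing_inv_mul h hh, Matrix.det_one]⟩
  map_one' := Subtype.ext (by
    change h⁻¹ * 1 * h = 1
    rw [mul_one, Matrix.nonsing_inv_mul h hh])
  map_mul' M N := Subtype.ext (by
    change h⁻¹ * (M.1 * N.1) * h = h⁻¹ * M.1 * h * (h⁻¹ * N.1 * h)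
    have := Matrix.mul_nonsing_inv h hh
    calc h⁻¹ * (M.1 * N.1) * h = h⁻¹ * M.1 * 1 * N.1 * h := by rw [mul_one]; simp only [mul_assoc]
      _ = _ := by rw [← this]; simp only [mul_assoc])

/-- A nonscalar element of `SL₂` is conjugate to a companion matrix. -/
theorem exists_conj_companion {C : SL(2, ℝ)} (hC : ∀ a : ℝ, C.1 ≠ a • 1) :
    ∃ (p q : ℝ) (v0 v1 : ℤ), !![(v0 : ℝ), p; (v1 : ℝ), q].det ≠ 0 ∧
      C.1 * !![(v0 : ℝ), p; (v1 : ℝ), q] =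
        !![(v0 : ℝ), p; (v1 : ℝ), q] * !![0, -1; 1, C.1.trace] := by
  have hdet : C.1 0 0 * C.1 1 1 - C.1 0 1 * C.1 1 0 = 1 := by
    have := C.2; rwa [Matrix.det_fin_two] at this
  -- The conjugator has columns `v` and `C v`; Cayley-Hamilton gives `C (C v) = tr C • C v - v`.
  -- Since `v` can be taken integral, the conjugator costs only the two entries of `C v`.
  obtain ⟨v0, v1, hv⟩ : ∃ v0 v1 : ℤ,
      (v0 * (C.1 1 0 * v0 + C.1 1 1 * v1) - v1 * (C.1 0 0 * v0 + C.1 0 1 * v1) : ℝ) ≠ 0 := by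
    by_contra hcon
    push Not at hcon
    have h1 := hcon 1 0
    have h2 := hcon 0 1
    have h3 := hcon 1 1
    norm_num at h1 h2 h3
    apply hC (C.1 0 0)
    ext i j
    fin_cases i <;> fin_cases j <;> simp
    · exact h2
    · exact h1
    · linarith
  refine ⟨C.1 0 0 * v0 + C.1 0 1 * v1, C.1 1 0 * v0 + C.1 1 1 * v1, v0, v1, ?_, ?_⟩
  · rw [Matrix.det_fin_two_of]
    intro h0
    apply hv
    linear_combination h0
  · ext i j
    rw [Matrix.trace_fin_two]
    fin_cases i <;> fin_cases j <;> simp [Matrix.mul_apply, Fin.sum_univ_two]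
    · linear_combination (-(v0 : ℝ)) * hdet
    · linear_combination (-(v1 : ℝ)) * hdet

section charts

variable {g N : ℕ}

/-- The real matrix obtained by evaluating the entries at `x`. -/
noncomputable def evalMat (x : Fin N → ℝ) (B : Matrix (Fin 2) (Fin 2) (MvPolynomial (Fin N) ℤ)) :
    Matrix (Fin 2) (Fin 2) ℝ := B.map (MvPolynomial.aeval x)

/-- After conjugation by the value of `H` at `x`, the tuple `A` is up to scaling the value of the
polynomial matrices `B` at `x`. -/
def RepresentedAt (B : Fin (2 * g) → Matrix (Fin 2) (Fin 2) (MvPolynomial (Fin N) ℤ))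
    (H : Matrix (Fin 2) (Fin 2) (MvPolynomial (Fin N) ℤ)) (x : Fin N → ℝ)
    (A : Fin (2 * g) → SL(2, ℝ)) : Prop :=
  (evalMat x H).det ≠ 0 ∧ ∃ c : Fin (2 * g) → ℝ, (∀ i, c i ≠ 0) ∧
    ∀ i, evalMat x H * evalMat x (B i) = c i • ((A i).1 * evalMat x H)

theorem exists_representedAt {S : Finset ℝ} {d e : ℕ} (hN : 0 < N) (hS : S.card ≤ N)
    {A A' : Fin (2 * g) → SL(2, ℝ)} {h : Matrix (Fin 2) (Fin 2) ℝ} (hh : MatPolyValue S e h)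
    (hdet : h.det ≠ 0) (hA : ∀ i, h * (A' i).1 = (A i).1 * h)
    (hA' : ∀ i, ProjPolyValue S d (A' i).1) :
    ∃ (B : Fin (2 * g) → Matrix (Fin 2) (Fin 2) (MvPolynomial (Fin N) ℤ))
      (H : Matrix (Fin 2) (Fin 2) (MvPolynomial (Fin N) ℤ)) (x : Fin N → ℝ),
      (∀ i a b, (B i a b).totalDegree ≤ d) ∧ RepresentedAt B H x A := by
  obtain ⟨x, hx⟩ := PolyValue.exists_fin hN hS
  choose c hc hB using hA'
  choose B hBd hBx using fun i a b => hx _ _ (hB i a b)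
  choose H hHd hHx using fun a b => hx _ _ (hh a b)
  have e1 : evalMat x (Matrix.of H) = h := by ext a b; exact hHx a b
  have e2 : ∀ i, evalMat x (Matrix.of (B i)) = c i • (A' i).1 := by
    intro i; ext a b; exact hBx i a b
  refine ⟨fun i => Matrix.of (B i), Matrix.of H, x, hBd, by rwa [e1], c, hc, fun i => ?_⟩
  rw [e1, e2, Matrix.mul_smul, hA]

/-- Solutions of the surface relation are represented by polynomial matrices of small degree in
`6g-3` parameters, or by polynomial matrices in `6g-4` parameters. -/
theorem exists_representedAt_of_mem_surfaceTuples {k : ℕ} {A : Fin (2 * (k + 2)) → SL(2, ℝ)}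
    (hA : A ∈ surfaceTuples (k + 2)) :
    (∃ (B : Fin (2 * (k + 2)) → Matrix (Fin 2) (Fin 2) (MvPolynomial (Fin (6 * k + 9)) ℤ))
      (H : Matrix (Fin 2) (Fin 2) (MvPolynomial (Fin (6 * k + 9)) ℤ)) (x : Fin (6 * k + 9) → ℝ),
      (∀ i a b, (B i a b).totalDegree ≤ 8 * k + 4) ∧ RepresentedAt B H x A) ∨
    (∃ (B : Fin (2 * (k + 2)) → Matrix (Fin 2) (Fin 2) (MvPolynomial (Fin (6 * k + 8)) ℤ))
      (H : Matrix (Fin 2) (Fin 2) (MvPolynomial (Fin (6 * k + 8)) ℤ)) (x : Fin (6 * k + 8) → ℝ),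
      RepresentedAt B H x A) := by
  have hrel : commutatorProduct A = 1 := hA
  -- Rotating the relation cyclically shows that the tail times `C⁻¹` is the inverse of the second
  -- commutator. The tuple is arbitrary so that a conjugate of the given one is covered as well.
  have key : ∀ (A : Fin (2 * (k + 2)) → SL(2, ℝ)), commutatorProduct A = 1 →
      ∀ C, C = (A ⟨0, by omega⟩ * A ⟨1, by omega⟩ * (A ⟨0, by omega⟩)⁻¹ * (A ⟨1, by omega⟩)⁻¹)⁻¹ →
      C * A ⟨0, by omega⟩ * A ⟨1, by omega⟩ = A ⟨1, by omega⟩ * A ⟨0, by omega⟩ ∧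
      (tailCommutatorProduct A * C⁻¹) * A ⟨2, by omega⟩ * A ⟨3, by omega⟩ =
        A ⟨3, by omega⟩ * A ⟨2, by omega⟩ := by
    intro A hrel C hC
    rw [commutatorProduct_eq] at hrel
    generalize A ⟨0, by omega⟩ = a at *
    generalize A ⟨1, by omega⟩ = b at *
    generalize A ⟨2, by omega⟩ = x at *
    generalize A ⟨3, by omega⟩ = y at *
    generalize tailCommutatorProduct A = t at *
    subst hC
    refine ⟨by group, ?_⟩
    rw [inv_inv]
    have h1 : t * (a * b * a⁻¹ * b⁻¹) * (x * y * x⁻¹ * y⁻¹) = 1 := by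
      have := congrArg (fun z => t * z * t⁻¹) hrel
      simp only [mul_one, mul_inv_cancel] at this
      rw [← this]; group
    calc t * (a * b * a⁻¹ * b⁻¹) * x * y
        = (t * (a * b * a⁻¹ * b⁻¹) * (x * y * x⁻¹ * y⁻¹)) * (y * x) := by group
      _ = y * x := by rw [h1, one_mul]
  obtain ⟨C, hC⟩ : ∃ C, C = (A ⟨0, by omega⟩ * A ⟨1, by omega⟩ * (A ⟨0, by omega⟩)⁻¹ *
    (A ⟨1, by omega⟩)⁻¹)⁻¹ := ⟨_, rfl⟩
  obtain ⟨h1, h2⟩ := key A hrel C hC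
  have low : (∀ S : Finset ℝ, FracPolyValue S (4 * k) (tailCommutatorProduct A).1 →
      FracPolyValue S (4 * k) C.1 ∧ FracPolyValue S (4 * k) (tailCommutatorProduct A * C⁻¹).1) →
      (∃ (B : Fin (2 * (k + 2)) → Matrix (Fin 2) (Fin 2) (MvPolynomial (Fin (6 * k + 8)) ℤ))
      (H : Matrix (Fin 2) (Fin 2) (MvPolynomial (Fin (6 * k + 8)) ℤ)) (x : Fin (6 * k + 8) → ℝ),
      RepresentedAt B H x A) := by
    intro hf
    obtain ⟨S, hS, hP⟩ := exists_projPolyValue_degenerate h1 h2 hf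
    obtain ⟨B, H, x, -, hB⟩ := exists_representedAt (e := 0) (h := 1) (by omega) hS
      MatPolyValue.one (by simp) (A := A) (fun i => by simp) hP
    exact ⟨B, H, x, hB⟩
  -- If `C = ±1`, or if the second commutator is trivial, both commutators are functions of the tail
  -- and the low-dimensional count applies.
  by_cases hsc : ∃ a : ℝ, C.1 = a • 1
  · right
    apply low
    intro S hf
    obtain ⟨a, ha⟩ := hsc
    have ha2 : a * a = 1 := by
      have := C.2
      rw [ha, Matrix.det_smul, Matrix.det_one] at this
      simpa [pow_two] using this
    have hcases : C = 1 ∨ C = -1 := by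
      rcases mul_self_eq_one_iff.mp ha2 with h | h
      · left; apply Subtype.ext; rw [ha, h, one_smul]; rfl
      · right; apply Subtype.ext; rw [ha, h, neg_smul, one_smul]; rfl
    rcases hcases with h | h
    · rw [h, inv_one, mul_one]
      exact ⟨FracPolyValue.one, hf⟩
    · have : (tailCommutatorProduct A * C⁻¹).1 = -(tailCommutatorProduct A).1 := by
        have : C⁻¹ = -1 := by rw [h]; exact inv_eq_of_mul_eq_one_left (by simp)
        rw [this, mul_neg, mul_one]; rfl
      rw [this, h]
      exact ⟨FracPolyValue.one.neg, hf.neg⟩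
  · push Not at hsc
    by_cases hC1 : tailCommutatorProduct A * C⁻¹ = 1
    · right
      apply low
      intro S hf
      have : C = tailCommutatorProduct A := (mul_inv_eq_one.mp hC1).symm
      rw [hC1, this]
      exact ⟨hf, FracPolyValue.one⟩
    · left
      obtain ⟨p, q, v0, v1, hdet, hcomp⟩ := exists_conj_companion hsc
      obtain ⟨h, hh⟩ : ∃ h, h = !![(v0 : ℝ), p; (v1 : ℝ), q] := ⟨_, rfl⟩
      rw [← hh] at hdet hcomp
      have hu : IsUnit h.det := isUnit_iff_ne_zero.mpr hdet
      set φ := conjHom h hu with hφ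
      have hφA : ∀ M : SL(2, ℝ), h * (φ M).1 = M.1 * h := by
        intro M
        change h * (h⁻¹ * M.1 * h) = M.1 * h
        rw [mul_assoc h⁻¹, ← mul_assoc, Matrix.mul_nonsing_inv h hu, one_mul]
      have hrel' : commutatorProduct (fun i => φ (A i)) = 1 := by
        rw [map_commutatorProduct, hrel, map_one]
      have ht : tailCommutatorProduct (fun i => φ (A i)) = φ (tailCommutatorProduct A) := by
        rw [tailCommutatorProduct, tailCommutatorProduct, map_list_prod, List.map_ofFn]
        congr 2
        funext i
        simp
      obtain ⟨h1', h2'⟩ := key (fun i => φ (A i)) hrel' (φ C) (by rw [hC]; simp)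
      have hcompφ : (φ C).1 = !![0, -1; 1, C.1.trace] := by
        change h⁻¹ * C.1 * h = _
        rw [mul_assoc, hcomp, ← mul_assoc, Matrix.nonsing_inv_mul h hu, one_mul]
      have hφinj : Function.Injective φ := by
        intro M M' hMM
        apply Subtype.ext
        have e : M.1 * h = M'.1 * h := by rw [← hφA, ← hφA, hMM]
        have := congrArg (· * h⁻¹) e
        simpa [mul_assoc, Matrix.mul_nonsing_inv h hu] using this
      have hne : tailCommutatorProduct (fun i => φ (A i)) * (φ C)⁻¹ ≠ 1 := by
        rw [ht, ← map_inv, ← map_mul]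
        exact fun h0 => hC1 (hφinj (h0.trans (map_one φ).symm))
      obtain ⟨S, hS, hP⟩ := exists_projPolyValue_companion (A := fun i => φ (A i)) (C := φ C)
        (C₁ := tailCommutatorProduct (fun i => φ (A i)) * (φ C)⁻¹) hcompφ h1' h2'
        (Eq.refl (tailCommutatorProduct (fun i => φ (A i)) * (φ C)⁻¹)) hne
      have hsub : S ⊆ insert p (insert q S) :=
        (Finset.subset_insert q S).trans (Finset.subset_insert p _)
      refine exists_representedAt (S := insert p (insert q S)) (e := 1) (A := A)
        (A' := fun i => φ (A i)) (by omega)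
        ((Finset.card_insert_le _ _).trans
          ((Nat.succ_le_succ (Finset.card_insert_le _ _)).trans (by omega))) ?_ hdet
        (fun i => hφA (A i)) (fun i => (hP i).mono hsub le_rfl)
      rw [hh]
      intro i j
      fin_cases i <;> fin_cases j <;> simp
      · exact PolyValue.intCast v0
      · exact PolyValue.of_mem (by simp)
      · exact PolyValue.intCast v1
      · exact PolyValue.of_mem (by simp)

end charts

/-! ### Growth of the free group -/

section counting

variable {α : Type*} [Fintype α]

/-- There are at most `2m (2m-1)^n` reduced words of length `n+1` in `m` letters. -/
theorem FreeGroup.card_isReduced_le (n : ℕ) (F : Finset (List (α × Bool)))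
    (hF : ∀ L ∈ F, FreeGroup.IsReduced L ∧ L.length = n + 1) :
    F.card ≤ 2 * Fintype.card α * (2 * Fintype.card α - 1) ^ n := by
  classical
  induction n generalizing F with
  | zero =>
    have hsub : F ⊆ (Finset.univ : Finset (α × Bool)).image fun a => [a] := by
      intro L hL
      obtain ⟨a, rfl⟩ := List.length_eq_one_iff.mp (hF L hL).2
      simp
    refine (Finset.card_le_card hsub).trans (Finset.card_image_le.trans ?_)
    simp [mul_comm]
  | succ n ih =>
    -- Given its tail, a reduced word may start with any letter but the inverse of the next one.
    have h1 := Finset.card_le_mul_card_image (f := List.tail) F (2 * Fintype.card α - 1) (by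
      intro T hT
      obtain ⟨L, hL, hLT⟩ := Finset.mem_image.mp hT
      have hTl : T.length = n + 1 := by rw [← hLT, List.length_tail, (hF L hL).2]; rfl
      obtain ⟨b, T', rfl⟩ := List.exists_cons_of_length_eq_add_one hTl
      have hsub : (F.filter fun L => L.tail = b :: T') ⊆
          ((Finset.univ : Finset (α × Bool)).erase (b.1, !b.2)).image fun a => a :: b :: T' := by
        intro L hL
        obtain ⟨hL1, hL2⟩ := Finset.mem_filter.mp hL
        obtain ⟨a, L', rfl⟩ := List.exists_cons_of_length_eq_add_one (hF L hL1).2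
        simp only [List.tail_cons] at hL2
        subst hL2
        refine Finset.mem_image.mpr ⟨a, Finset.mem_erase.mpr ⟨?_, Finset.mem_univ _⟩, rfl⟩
        rintro rfl
        have := (FreeGroup.isReduced_cons_cons.mp (hF _ hL1).1).1 rfl
        simp at this
      refine (Finset.card_le_card hsub).trans (Finset.card_image_le.trans ?_)
      rw [Finset.card_erase_of_mem (Finset.mem_univ _)]
      simp [mul_comm])
    have h2 := ih (F.image List.tail) (by
      intro T hT
      obtain ⟨L, hL, rfl⟩ := Finset.mem_image.mp hT
      exact ⟨(hF L hL).1.infix (List.tail_suffix L).isInfix,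
        by rw [List.length_tail, (hF L hL).2]; rfl⟩)
    calc F.card ≤ (2 * Fintype.card α - 1) * (F.image List.tail).card := h1
      _ ≤ (2 * Fintype.card α - 1) * (2 * Fintype.card α * (2 * Fintype.card α - 1) ^ n) := by
          gcongr
      _ = _ := by ring

/-- The growth series of a free group converges below the inverse of the growth rate. -/
theorem FreeGroup.summable_pow_norm [DecidableEq α] {s : ℝ} (hs : 0 < s)
    (hs1 : (2 * Fintype.card α - 1 : ℕ) * s < 1) :
    Summable fun W : FreeGroup α => s ^ W.norm := by
  set q := 2 * Fintype.card α - 1 with hq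
  have hgeo : Summable fun n : ℕ => (2 * Fintype.card α * s) * ((q : ℝ) * s) ^ n :=
    (summable_geometric_of_lt_one (by positivity) hs1).mul_left _
  have hcount : ∀ (F : Finset (FreeGroup α)) (n : ℕ),
      ((F.filter fun W => W.norm = n + 1).card : ℝ) ≤ 2 * Fintype.card α * (q : ℝ) ^ n := by
    intro F n
    have := FreeGroup.card_isReduced_le n
      ((F.filter fun W => W.norm = n + 1).image FreeGroup.toWord)
      (by
        intro L hL
        obtain ⟨W, hW, rfl⟩ := Finset.mem_image.mp hL
        exact ⟨FreeGroup.isReduced_toWord, (Finset.mem_filter.mp hW).2⟩)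
    rw [Finset.card_image_of_injective _ FreeGroup.toWord_injective] at this
    exact_mod_cast this
  refine summable_of_sum_le (c := 1 + ∑' n : ℕ, (2 * Fintype.card α * s) * ((q : ℝ) * s) ^ n)
    (fun W => by positivity) fun F => ?_
  have hmaps : ∀ W ∈ F, W.norm ∈ Finset.range (F.sup FreeGroup.norm + 1) := by
    intro W hW
    rw [Finset.mem_range]
    exact Nat.lt_succ_of_le (Finset.le_sup hW)
  rw [← Finset.sum_fiberwise_of_maps_to hmaps, Finset.sum_range_succ', add_comm]
  gcongr
  · calc ∑ W ∈ F with W.norm = 0, s ^ W.norm ≤ ∑ W ∈ {(1 : FreeGroup α)}, s ^ W.norm := by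
          refine Finset.sum_le_sum_of_subset_of_nonneg ?_ fun _ _ _ => by positivity
          intro W hW
          rw [Finset.mem_singleton]
          exact FreeGroup.norm_eq_zero.mp (Finset.mem_filter.mp hW).2
      _ = 1 := by simp
  · refine (Finset.sum_le_sum fun n _ => ?_).trans
      (hgeo.sum_le_tsum (Finset.range (F.sup FreeGroup.norm)) fun n _ => by positivity)
    rw [Finset.sum_congr rfl fun W hW => by rw [(Finset.mem_filter.mp hW).2], Finset.sum_const,
      nsmul_eq_mul]
    calc _ ≤ (2 * Fintype.card α * (q : ℝ) ^ n) * s ^ (n + 1) := by gcongr; exact hcount F n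
      _ = _ := by rw [mul_pow]; ring

end counting

/-! ### Trace gaps as polynomials -/

section words

variable {m : ℕ} {R S : Type*} [CommRing R] [CommRing S]

/-- The value of a word at a tuple of matrices, with the adjugate in place of the inverse. -/
def wordMat (B : Fin m → Matrix (Fin 2) (Fin 2) R) (L : List (Fin m × Bool)) :
    Matrix (Fin 2) (Fin 2) R :=
  (L.map fun p => cond p.2 (B p.1) (B p.1).adjugate).prod

/-- The determinant of `wordMat`. -/
def wordDet (B : Fin m → Matrix (Fin 2) (Fin 2) R) (L : List (Fin m × Bool)) : R :=
  (L.map fun p => (B p.1).det).prod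

/-- The numerator of the difference of the squares of the normalized traces of two words. -/
def gapNumerator (B : Fin m → Matrix (Fin 2) (Fin 2) R) (L₁ L₂ : List (Fin m × Bool)) : R :=
  (wordMat B L₁).trace ^ 2 * wordDet B L₂ - (wordMat B L₂).trace ^ 2 * wordDet B L₁

theorem map_wordMat (f : R →+* S) (B : Fin m → Matrix (Fin 2) (Fin 2) R)
    (L : List (Fin m × Bool)) : (wordMat B L).map f = wordMat (fun i => (B i).map f) L := by
  induction L with
  | nil => simp [wordMat, Matrix.map_one]
  | cons p L ih =>
    have h1 : wordMat B (p :: L) = cond p.2 (B p.1) (B p.1).adjugate * wordMat B L := by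
      simp [wordMat]
    have h2 : wordMat (fun i => (B i).map f) (p :: L) =
        cond p.2 ((B p.1).map f) ((B p.1).map f).adjugate *
          wordMat (fun i => (B i).map f) L := by simp [wordMat]
    rw [h1, h2, Matrix.map_mul, ih]
    congr 1
    rcases p with ⟨i, _ | _⟩
    · exact RingHom.map_adjugate f (B i)
    · rfl

theorem map_wordDet (f : R →+* S) (B : Fin m → Matrix (Fin 2) (Fin 2) R)
    (L : List (Fin m × Bool)) : f (wordDet B L) = wordDet (fun i => (B i).map f) L := by
  rw [wordDet, wordDet, map_list_prod, List.map_map]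
  congr 1
  apply List.map_congr_left
  intro p _
  exact RingHom.map_det f (B p.1)

theorem map_gapNumerator (f : R →+* S) (B : Fin m → Matrix (Fin 2) (Fin 2) R)
    (L₁ L₂ : List (Fin m × Bool)) :
    f (gapNumerator B L₁ L₂) = gapNumerator (fun i => (B i).map f) L₁ L₂ := by
  have ht : ∀ L, f (wordMat B L).trace = (wordMat (fun i => (B i).map f) L).trace := by
    intro L
    rw [← map_wordMat, Matrix.trace_fin_two, Matrix.trace_fin_two, map_add]; rfl
  rw [gapNumerator, gapNumerator, map_sub, map_mul, map_mul, map_pow, map_pow, ht, ht,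
    map_wordDet, map_wordDet]

/-- The adjugate of a 2 by 2 matrix is linear in the entries, so inverse letters cost no more degree
than letters. -/
theorem totalDegree_wordMat_le {N d : ℕ}
    {B : Fin m → Matrix (Fin 2) (Fin 2) (MvPolynomial (Fin N) ℤ)}
    (hB : ∀ i a b, (B i a b).totalDegree ≤ d) (L : List (Fin m × Bool)) (a b : Fin 2) :
    (wordMat B L a b).totalDegree ≤ d * L.length := by
  induction L generalizing a b with
  | nil =>
    have : wordMat B [] = 1 := rfl
    rw [this, Matrix.one_apply]
    split_ifs <;> simp
  | cons p L ih =>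
    have h1 : wordMat B (p :: L) = cond p.2 (B p.1) (B p.1).adjugate * wordMat B L := by
      simp [wordMat]
    have h2 : ∀ a b, (cond p.2 (B p.1) (B p.1).adjugate a b).totalDegree ≤ d := by
      intro a b
      rcases p with ⟨i, _ | _⟩
      · change ((B i).adjugate a b).totalDegree ≤ d
        rw [Matrix.adjugate_fin_two]
        fin_cases a <;> fin_cases b <;> simp [hB]
      · exact hB i a b
    rw [h1, Matrix.mul_apply, Fin.sum_univ_two, List.length_cons, mul_add, mul_one,
      add_comm (d * _)]
    exact (MvPolynomial.totalDegree_add _ _).trans (max_le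
      ((MvPolynomial.totalDegree_mul _ _).trans (add_le_add (h2 _ _) (ih _ _)))
      ((MvPolynomial.totalDegree_mul _ _).trans (add_le_add (h2 _ _) (ih _ _))))

theorem totalDegree_wordDet_le {N d : ℕ}
    {B : Fin m → Matrix (Fin 2) (Fin 2) (MvPolynomial (Fin N) ℤ)}
    (hB : ∀ i a b, (B i a b).totalDegree ≤ d) (L : List (Fin m × Bool)) :
    (wordDet B L).totalDegree ≤ 2 * d * L.length := by
  induction L with
  | nil => simp [wordDet]
  | cons p L ih =>
    have h1 : wordDet B (p :: L) = (B p.1).det * wordDet B L := by simp [wordDet]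
    have h2 : (B p.1).det.totalDegree ≤ 2 * d := by
      rw [Matrix.det_fin_two, two_mul]
      exact (MvPolynomial.totalDegree_sub _ _).trans (max_le
        ((MvPolynomial.totalDegree_mul _ _).trans (add_le_add (hB _ _ _) (hB _ _ _)))
        ((MvPolynomial.totalDegree_mul _ _).trans (add_le_add (hB _ _ _) (hB _ _ _))))
    rw [h1, List.length_cons, mul_add, mul_one, add_comm (2 * d * _)]
    exact (MvPolynomial.totalDegree_mul _ _).trans (add_le_add h2 ih)

theorem totalDegree_gapNumerator_le {N d : ℕ}
    {B : Fin m → Matrix (Fin 2) (Fin 2) (MvPolynomial (Fin N) ℤ)}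
    (hB : ∀ i a b, (B i a b).totalDegree ≤ d) (L₁ L₂ : List (Fin m × Bool)) :
    (gapNumerator B L₁ L₂).totalDegree ≤ 2 * d * (L₁.length + L₂.length) := by
  have key : ∀ L L' : List (Fin m × Bool), ((wordMat B L).trace ^ 2 * wordDet B L').totalDegree ≤
      2 * d * (L.length + L'.length) := by
    intro L L'
    have h1 : (wordMat B L).trace.totalDegree ≤ d * L.length := by
      rw [Matrix.trace_fin_two]
      exact (MvPolynomial.totalDegree_add _ _).trans
        (max_le (totalDegree_wordMat_le hB L _ _) (totalDegree_wordMat_le hB L _ _))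
    calc _ ≤ ((wordMat B L).trace ^ 2).totalDegree + (wordDet B L').totalDegree :=
          MvPolynomial.totalDegree_mul _ _
      _ ≤ 2 * (d * L.length) + 2 * d * L'.length :=
          add_le_add ((MvPolynomial.totalDegree_pow _ _).trans (by gcongr))
            (totalDegree_wordDet_le hB L')
      _ = _ := by ring
  refine (MvPolynomial.totalDegree_sub _ _).trans (max_le (key _ _) ?_)
  rw [add_comm L₁.length]
  exact key _ _

end words

/-! ### Borel-Cantelli over all pairs of words -/

open MeasureTheory in
/-- At almost every point, nonvanishing values of the polynomials `gapNumerator` are not too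
small. -/
theorem ae_exists_le_abs_aeval_gapNumerator {m N d : ℕ} (hm : 0 < m)
    {B : Fin m → Matrix (Fin 2) (Fin 2) (MvPolynomial (Fin N) ℤ)}
    (hB : ∀ i a b, (B i a b).totalDegree ≤ d) {r : ℝ} (hr : 0 < r)
    (hr1 : (2 * m - 1 : ℕ) * r < 1) :
    ∀ᵐ x : Fin N → ℝ, ∃ K : ℝ, 0 < K ∧ ∀ W₁ W₂ : FreeGroup (Fin m),
      MvPolynomial.aeval x (gapNumerator B W₁.toWord W₂.toWord) = 0 ∨
      K * r ^ (2 * d * (W₁.norm + W₂.norm) ^ 2) ≤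
        |MvPolynomial.aeval x (gapNumerator B W₁.toWord W₂.toWord)| := by
  have hq : 1 ≤ 2 * m - 1 := by omega
  have hq' : (1 : ℝ) ≤ (2 * m - 1 : ℕ) := by exact_mod_cast hq
  have hr_lt : r < 1 := by nlinarith
  -- The exceptional sets have measure `O(D W * θ W)`, summable because `r` is below the inverse of
  -- the growth rate, while the threshold `θ W ^ D W` has an exponent quadratic in the word lengths.
  set θ : FreeGroup (Fin m) × FreeGroup (Fin m) → ℝ := fun W => r ^ (W.1.norm + W.2.norm) with hθ
  have hθ0 : ∀ W, 0 < θ W := fun W => by positivity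
  have hθ1 : ∀ W, θ W ≤ 1 := fun W => pow_le_one₀ hr.le hr_lt.le
  set D : FreeGroup (Fin m) × FreeGroup (Fin m) → ℕ :=
    fun W => 2 * d * (W.1.norm + W.2.norm) with hD
  have hsum : Summable fun W : FreeGroup (Fin m) × FreeGroup (Fin m) =>
      ((W.1.norm + W.2.norm : ℕ) : ℝ) * r ^ (W.1.norm + W.2.norm) := by
    -- The linear factor coming from the degree is absorbed by enlarging `r` slightly to `s`.
    obtain ⟨s, hrs, hs1⟩ : ∃ s, r < s ∧ (2 * m - 1 : ℕ) * s < 1 := by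
      obtain ⟨s, h1, h2⟩ := exists_between (show r < ((2 * m - 1 : ℕ) : ℝ)⁻¹ by
        rw [lt_inv_comm₀ hr (by linarith), lt_inv_comm₀ (by linarith) hr]
        rw [← one_div, lt_div_iff₀ (by linarith)]; linarith)
      refine ⟨s, h1, ?_⟩
      rw [← one_div, lt_div_iff₀ (by linarith)] at h2
      linarith
    have hs0 : 0 < s := hr.trans hrs
    have h1 := FreeGroup.summable_pow_norm (α := Fin m) hs0 (by rwa [Fintype.card_fin])
    have h2 := h1.mul_of_nonneg h1 (fun W => by positivity) (fun W => by positivity)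
    have hlim := tendsto_self_mul_const_pow_of_lt_one (r := r / s) (by positivity)
      ((div_lt_one hs0).mpr hrs)
    obtain ⟨C, hC⟩ := hlim.bddAbove_range
    refine Summable.of_nonneg_of_le (fun W => by positivity) (fun W => ?_) (h2.mul_left C)
    have h3 : ((W.1.norm + W.2.norm : ℕ) : ℝ) * (r / s) ^ (W.1.norm + W.2.norm) ≤ C :=
      hC ⟨W.1.norm + W.2.norm, rfl⟩
    rw [← pow_add]
    calc ((W.1.norm + W.2.norm : ℕ) : ℝ) * r ^ (W.1.norm + W.2.norm)
        = ((W.1.norm + W.2.norm : ℕ) : ℝ) * (r / s) ^ (W.1.norm + W.2.norm) *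
            s ^ (W.1.norm + W.2.norm) := by
          rw [mul_assoc, ← mul_pow, div_mul_cancel₀ _ hs0.ne']
      _ ≤ _ := by gcongr
  have hae : ∀ M : ℕ, ∀ᵐ x : Fin N → ℝ, {W : FreeGroup (Fin m) × FreeGroup (Fin m) |
      gapNumerator B W.1.toWord W.2.toWord ≠ 0 ∧ (∀ i, |x i| ≤ (M + 1 : ℕ)) ∧
      |MvPolynomial.aeval x (gapNumerator B W.1.toWord W.2.toWord)| < θ W ^ D W}.Finite := by
    intro M
    have hM : (1 : ℝ) ≤ (M + 1 : ℕ) := by exact_mod_cast Nat.le_add_left 1 M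
    have hvol : ∀ W : FreeGroup (Fin m) × FreeGroup (Fin m),
        volume {x : Fin N → ℝ | gapNumerator B W.1.toWord W.2.toWord ≠ 0 ∧
          (∀ i, |x i| ≤ (M + 1 : ℕ)) ∧
          |MvPolynomial.aeval x (gapNumerator B W.1.toWord W.2.toWord)| < θ W ^ D W} ≤
        ENNReal.ofReal ((N * 4 * d * (2 * (M + 1 : ℕ)) ^ N) *
          (((W.1.norm + W.2.norm : ℕ) : ℝ) * r ^ (W.1.norm + W.2.norm))) := by
      intro W
      by_cases h0 : gapNumerator B W.1.toWord W.2.toWord = 0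
      · simp [h0]
      · refine (measure_mono fun x hx => hx.2).trans
          ((volume_abs_aeval_lt_le hM (hθ0 W) (hθ1 W) N (D W) _ h0
            (totalDegree_gapNumerator_le hB _ _)).trans ?_)
        apply ENNReal.ofReal_le_ofReal
        rw [hD, hθ]
        push_cast
        exact le_of_eq (by ring)
    refine ae_finite_setOfPred_mem (μ := volume)
      (s := fun W : FreeGroup (Fin m) × FreeGroup (Fin m) =>
      {x : Fin N → ℝ | gapNumerator B W.1.toWord W.2.toWord ≠ 0 ∧ (∀ i, |x i| ≤ (M + 1 : ℕ)) ∧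
      |MvPolynomial.aeval x (gapNumerator B W.1.toWord W.2.toWord)| < θ W ^ D W}) ?_
    refine ne_top_of_le_ne_top ?_ (ENNReal.tsum_le_tsum hvol)
    rw [← ENNReal.ofReal_tsum_of_nonneg (fun W => by positivity) (hsum.mul_left _)]
    exact ENNReal.ofReal_ne_top
  filter_upwards [ae_all_iff.mpr hae] with x hx
  obtain ⟨M, hM⟩ : ∃ M : ℕ, ∀ i, |x i| ≤ (M + 1 : ℕ) := by
    obtain ⟨M, hM⟩ := exists_nat_ge (∑ i, |x i|)
    refine ⟨M, fun i => ?_⟩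
    have := Finset.single_le_sum (f := fun i => |x i|) (fun i _ => abs_nonneg _) (Finset.mem_univ i)
    push_cast
    linarith
  set P : FreeGroup (Fin m) × FreeGroup (Fin m) → ℝ :=
    fun W => MvPolynomial.aeval x (gapNumerator B W.1.toWord W.2.toWord) with hP
  have hfin := hx M
  -- The finitely many exceptional pairs only lower the constant.
  obtain ⟨K, hK0, hK⟩ : ∃ K : ℝ, 0 < K ∧ ∀ W ∈ hfin.toFinset, P W ≠ 0 → K ≤ |P W| := by
    generalize hfin.toFinset = F
    classical
    induction F using Finset.induction_on with
    | empty => exact ⟨1, one_pos, by simp⟩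
    | insert a F _ ih =>
      obtain ⟨K, hK0, hK⟩ := ih
      by_cases ha : P a = 0
      · refine ⟨K, hK0, fun W hW hWP => ?_⟩
        rcases Finset.mem_insert.mp hW with rfl | hW
        · exact absurd ha hWP
        · exact hK W hW hWP
      · refine ⟨min K |P a|, lt_min hK0 (abs_pos.mpr ha), fun W hW hWP => ?_⟩
        rcases Finset.mem_insert.mp hW with rfl | hW
        · exact min_le_right _ _
        · exact (min_le_left _ _).trans (hK W hW hWP)
  refine ⟨min K 1, lt_min hK0 one_pos, fun W₁ W₂ => ?_⟩
  by_cases h0 : P (W₁, W₂) = 0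
  · exact Or.inl h0
  right
  change min K 1 * r ^ (2 * d * (W₁.norm + W₂.norm) ^ 2) ≤ |P (W₁, W₂)|
  have hpow : θ (W₁, W₂) ^ D (W₁, W₂) = r ^ (2 * d * (W₁.norm + W₂.norm) ^ 2) := by
    rw [hθ, hD]
    simp only
    rw [← pow_mul]
    congr 1
    ring
  by_cases hmem : (W₁, W₂) ∈ hfin.toFinset
  · calc _ ≤ K * 1 := by
          gcongr
          · exact min_le_left _ _
          · exact pow_le_one₀ hr.le hr_lt.le
      _ ≤ _ := by rw [mul_one]; exact hK _ hmem h0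
  · rw [Set.Finite.mem_toFinset] at hmem
    have hge : θ (W₁, W₂) ^ D (W₁, W₂) ≤ |P (W₁, W₂)| := by
      by_contra hlt
      refine hmem ⟨?_, hM, not_le.mp hlt⟩
      intro hz
      apply h0
      rw [hP]
      simp only
      rw [hz, map_zero]
    rw [hpow] at hge
    refine le_trans ?_ hge
    calc _ ≤ 1 * r ^ (2 * d * (W₁.norm + W₂.norm) ^ 2) := by
          gcongr
          exact min_le_right _ _
      _ = _ := one_mul _

/-! ### Null sets of parameters and null sets of tuples -/

-- A C¹ map is locally Lipschitz, and countably many of the Lipschitz neighbourhoods cover `Z`.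
open MeasureTheory in
theorem hausdorffMeasure_image_eq_zero_of_contDiffAt {ι κ : Type*} [Fintype ι] [Fintype κ]
    {f : (ι → ℝ) → (κ → ℝ)} {Z : Set (ι → ℝ)} (hf : ∀ x ∈ Z, ContDiffAt ℝ 1 f x) {s : ℝ}
    (hs : 0 ≤ s) (hZ : μH[s] Z = 0) : μH[s] (f '' Z) = 0 := by
  choose! K t ht hL using fun x hx => (hf x hx).exists_lipschitzOnWith
  obtain ⟨u, huZ, huc, hu⟩ := TopologicalSpace.countable_cover_nhdsWithin (f := t) (s := Z)
    fun x hx => mem_nhdsWithin_of_mem_nhds (ht x hx)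
  have hsub : f '' Z ⊆ ⋃ x ∈ u, f '' (t x ∩ Z) := by
    rintro _ ⟨x, hx, rfl⟩
    obtain ⟨y, hy, hxy⟩ := Set.mem_iUnion₂.mp (hu hx)
    exact Set.mem_iUnion₂.mpr ⟨y, hy, x, ⟨hxy, hx⟩, rfl⟩
  refine measure_mono_null hsub ((measure_biUnion_null_iff huc).mpr fun x hx => ?_)
  have h1 := ((hL x (huZ hx)).mono Set.inter_subset_left :
    LipschitzOnWith (K x) f (t x ∩ Z)).hausdorffMeasure_image_le hs
  rw [measure_mono_null Set.inter_subset_right hZ, mul_zero] at h1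
  exact le_antisymm h1 bot_le

section charts

variable {g N : ℕ}

theorem contDiff_aeval (p : MvPolynomial (Fin N) ℤ) :
    ContDiff ℝ 1 fun x : Fin N → ℝ => MvPolynomial.aeval x p := by
  induction p using MvPolynomial.induction_on with
  | C a => simpa using contDiff_const
  | add p q hp hq => simpa using hp.add hq
  | mul_X p i hp => simpa using hp.mul (contDiff_apply ℝ ℝ i)

theorem contDiff_det_evalMat (B : Matrix (Fin 2) (Fin 2) (MvPolynomial (Fin N) ℤ)) :
    ContDiff ℝ 1 fun x : Fin N → ℝ => (evalMat x B).det := by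
  simp only [Matrix.det_fin_two]
  exact ((contDiff_aeval (B 0 0)).mul (contDiff_aeval (B 1 1))).sub
    ((contDiff_aeval (B 0 1)).mul (contDiff_aeval (B 1 0)))

/-- The entries of the matrices `±B i / √(det (B i))`, conjugated by `H`. -/
noncomputable def chartMap
    (B : Fin (2 * g) → Matrix (Fin 2) (Fin 2) (MvPolynomial (Fin N) ℤ))
    (H : Matrix (Fin 2) (Fin 2) (MvPolynomial (Fin N) ℤ)) (ε : Fin (2 * g) → ℤ) (x : Fin N → ℝ) :
    Fin (2 * g) × Fin 2 × Fin 2 → ℝ :=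
  fun p => ε p.1 * (√(evalMat x (B p.1)).det)⁻¹ * ((evalMat x H).det)⁻¹ *
    MvPolynomial.aeval x ((H * B p.1 * H.adjugate) p.2.1 p.2.2)

theorem RepresentedAt.det_eq {B : Fin (2 * g) → Matrix (Fin 2) (Fin 2) (MvPolynomial (Fin N) ℤ)}
    {H : Matrix (Fin 2) (Fin 2) (MvPolynomial (Fin N) ℤ)} {x : Fin N → ℝ}
    {A : Fin (2 * g) → SL(2, ℝ)} {c : Fin (2 * g) → ℝ} (hH : (evalMat x H).det ≠ 0)
    (h : ∀ i, evalMat x H * evalMat x (B i) = c i • ((A i).1 * evalMat x H)) (i : Fin (2 * g)) :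
    (evalMat x (B i)).det = c i ^ 2 := by
  have h1 := congrArg Matrix.det (h i)
  rw [Matrix.det_mul, Matrix.det_smul, Matrix.det_mul, (A i).2, one_mul, mul_comm] at h1
  simpa using mul_right_cancel₀ hH h1

/-- Since `det (B i) = c i ^ 2`, the unknown scaling is determined by `x` up to a sign. The tuple is
thus a function of `x` and discrete data, smooth near `x` because the determinants do not vanish
there. -/
theorem RepresentedAt.exists_chartMap_eq
    {B : Fin (2 * g) → Matrix (Fin 2) (Fin 2) (MvPolynomial (Fin N) ℤ)}
    {H : Matrix (Fin 2) (Fin 2) (MvPolynomial (Fin N) ℤ)} {x : Fin N → ℝ}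
    {A : Fin (2 * g) → SL(2, ℝ)} (h : RepresentedAt B H x A) :
    ∃ ε, chartMap B H ε x = entries A ∧ ContDiffAt ℝ 1 (chartMap B H ε) x := by
  obtain ⟨hH, c, hc, h⟩ := h
  have hdet := RepresentedAt.det_eq hH h
  refine ⟨fun i => (SignType.sign (c i) : ℤ), ?_, ?_⟩
  · funext ⟨i, a, b⟩
    have e1 : (MvPolynomial.aeval x ((H * B i * H.adjugate) a b) : ℝ) =
        (evalMat x H * evalMat x (B i) * (evalMat x H).adjugate) a b := by
      have e2 : (evalMat x H).adjugate = H.adjugate.map (MvPolynomial.aeval x) :=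
        (RingHom.map_adjugate (MvPolynomial.aeval (R := ℤ) x).toRingHom H).symm
      rw [e2, evalMat, evalMat]
      have h1 : ∀ M M' : Matrix (Fin 2) (Fin 2) (MvPolynomial (Fin N) ℤ),
          (M * M').map (MvPolynomial.aeval (R := ℤ) x) =
            M.map (MvPolynomial.aeval (R := ℤ) x) * M'.map (MvPolynomial.aeval (R := ℤ) x) :=
        fun M M' => Matrix.map_mul (f := (MvPolynomial.aeval (R := ℤ) x).toRingHom)
      rw [← h1, ← h1]
      rfl
    have e3 : evalMat x H * evalMat x (B i) * (evalMat x H).adjugate =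
        (c i * (evalMat x H).det) • (A i).1 := by
      rw [h, Matrix.smul_mul, mul_assoc, Matrix.mul_adjugate, Matrix.mul_smul, mul_one, smul_smul]
    rw [chartMap]
    simp only
    rw [e1, e3, hdet, Real.sqrt_sq_eq_abs, Matrix.smul_apply, smul_eq_mul]
    have e4 : (((SignType.sign (c i) : ℤ) : ℝ)) * |c i|⁻¹ * c i = 1 := by
      rcases lt_or_gt_of_ne (hc i) with hlt | hgt
      · rw [sign_neg hlt, abs_of_neg hlt]
        have := hc i
        simp
        field_simp
      · rw [sign_pos hgt, abs_of_pos hgt]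
        have := hc i
        simp
        field_simp
    calc _ = (((SignType.sign (c i) : ℤ) : ℝ) * |c i|⁻¹ * c i) *
          (((evalMat x H).det)⁻¹ * (evalMat x H).det) * (A i).1 a b := by ring
      _ = (A i).1 a b := by rw [e4, inv_mul_cancel₀ hH]; ring
  · refine contDiffAt_pi.mpr fun p => ?_
    have hd : (evalMat x (B p.1)).det ≠ 0 := by rw [hdet]; exact pow_ne_zero 2 (hc p.1)
    exact ((contDiffAt_const.mul (((contDiff_det_evalMat (B p.1)).contDiffAt.sqrt hd).inv (by
      rw [Real.sqrt_ne_zero', hdet]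
      have := hc p.1
      positivity))).mul ((contDiff_det_evalMat H).contDiffAt.inv hH)).mul
      (contDiff_aeval _).contDiffAt

open MeasureTheory in
/-- A set of tuples represented at points of null sets is null. -/
theorem hausdorffMeasure_entries_image_eq_zero {s : ℝ} (hs : 0 ≤ s)
    {T : Set (Fin (2 * g) → SL(2, ℝ))}
    (Q : (Fin (2 * g) → Matrix (Fin 2) (Fin 2) (MvPolynomial (Fin N) ℤ)) → Prop)
    (Z : (Fin (2 * g) → Matrix (Fin 2) (Fin 2) (MvPolynomial (Fin N) ℤ)) → Set (Fin N → ℝ))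
    (hZ : ∀ B, Q B → μH[s] (Z B) = 0)
    (hT : ∀ A ∈ T, ∃ B H x, Q B ∧ x ∈ Z B ∧ RepresentedAt B H x A) :
    μH[s] (entries '' T) = 0 := by
  -- Integer coefficients make the family of charts countable.
  have : Countable (MvPolynomial (Fin N) ℤ) := by
    have := (MvPolynomial.cardinalMk_le_max (σ := Fin N) (R := ℤ))
    rw [← Cardinal.mk_le_aleph0_iff]
    exact this.trans (by simp)
  have : Countable (Matrix (Fin 2) (Fin 2) (MvPolynomial (Fin N) ℤ)) :=
    inferInstanceAs (Countable (Fin 2 → Fin 2 → MvPolynomial (Fin N) ℤ))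
  let I := (Fin (2 * g) → Matrix (Fin 2) (Fin 2) (MvPolynomial (Fin N) ℤ)) ×
    Matrix (Fin 2) (Fin 2) (MvPolynomial (Fin N) ℤ) × (Fin (2 * g) → ℤ)
  have hsub : entries '' T ⊆ ⋃ i : I, chartMap i.1 i.2.1 i.2.2 ''
      {x | Q i.1 ∧ x ∈ Z i.1 ∧ ContDiffAt ℝ 1 (chartMap i.1 i.2.1 i.2.2) x} := by
    rintro _ ⟨A, hA, rfl⟩
    obtain ⟨B, H, x, hQ, hx, hrep⟩ := hT A hA
    obtain ⟨ε, h1, h2⟩ := hrep.exists_chartMap_eq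
    exact Set.mem_iUnion.mpr ⟨(B, H, ε), x, ⟨hQ, hx, h2⟩, h1⟩
  refine measure_mono_null hsub (measure_iUnion_null fun i => ?_)
  by_cases hQ : Q i.1
  · exact hausdorffMeasure_image_eq_zero_of_contDiffAt (fun x hx => hx.2.2) hs
      (measure_mono_null (fun x hx => hx.2.1) (hZ _ hQ))
  · have : {x | Q i.1 ∧ x ∈ Z i.1 ∧ ContDiffAt ℝ 1 (chartMap i.1 i.2.1 i.2.2) x} = ∅ := by
      ext x; simp [hQ]
    rw [this, Set.image_empty, measure_empty]

/-! ### From polynomial values back to traces -/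

/-- The value of an unreduced word. -/
noncomputable def listValue (A : Fin (2 * g) → SL(2, ℝ)) (L : List (Fin (2 * g) × Bool)) :
    SL(2, ℝ) :=
  (L.map fun p => cond p.2 (A p.1) (A p.1)⁻¹).prod

theorem listValue_cons (A : Fin (2 * g) → SL(2, ℝ)) (p : Fin (2 * g) × Bool)
    (L : List (Fin (2 * g) × Bool)) :
    listValue A (p :: L) = cond p.2 (A p.1) (A p.1)⁻¹ * listValue A L := by simp [listValue]

theorem evalWord_eq_listValue (A : Fin (2 * g) → SL(2, ℝ)) (W : FreeGroup (Fin (2 * g))) :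
    evalWord A W = listValue A W.toWord := by
  conv_lhs => rw [← FreeGroup.mk_toWord (x := W)]
  exact FreeGroup.lift_mk

/-- Each letter, inverted or not, contributes its factor `c i` to the word matrix and `c i ^ 2` to
the word determinant; `δ` is the latter. Conjugation by `H` disappears in the trace, which is why
the degree of `H` never matters. -/
theorem RepresentedAt.exists_aeval_gapNumerator_eq
    {B : Fin (2 * g) → Matrix (Fin 2) (Fin 2) (MvPolynomial (Fin N) ℤ)}
    {H : Matrix (Fin 2) (Fin 2) (MvPolynomial (Fin N) ℤ)} {x : Fin N → ℝ}
    {A : Fin (2 * g) → SL(2, ℝ)} (h : RepresentedAt B H x A) :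
    ∃ Λ : ℝ, 1 ≤ Λ ∧ ∃ δ : FreeGroup (Fin (2 * g)) → ℝ, (∀ W, 0 < δ W ∧ δ W ≤ Λ ^ W.norm) ∧
      ∀ W₁ W₂, MvPolynomial.aeval x (gapNumerator B W₁.toWord W₂.toWord) =
        δ W₁ * δ W₂ * ((evalWord A W₁).1.trace ^ 2 - (evalWord A W₂).1.trace ^ 2) := by
  obtain ⟨hH, c, hc, h⟩ := h
  have hdet := RepresentedAt.det_eq hH h
  set b : Fin (2 * g) → Matrix (Fin 2) (Fin 2) ℝ := fun i => evalMat x (B i) with hb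
  set M := evalMat x H with hM
  have hu : IsUnit M.det := isUnit_iff_ne_zero.mpr hH
  have hadj : ∀ i, M * (b i).adjugate = c i • ((A i)⁻¹.1 * M) := by
    intro i
    have h1 : (A i)⁻¹.1 * (A i).1 = 1 := congrArg Subtype.val (inv_mul_cancel (A i))
    have h2 : (A i)⁻¹.1 * (M * b i) * (b i).adjugate = c i • (M * (b i).adjugate) := by
      rw [h, Matrix.mul_smul, ← mul_assoc, h1, one_mul, Matrix.smul_mul]
    rw [← mul_assoc, mul_assoc, Matrix.mul_adjugate, hdet, Matrix.mul_smul, mul_one, pow_two,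
      mul_smul] at h2
    exact (smul_right_injective _ (hc i) h2).symm
  have hword : ∀ L : List (Fin (2 * g) × Bool), M * wordMat b L =
      (L.map fun p => c p.1).prod • ((listValue A L).1 * M) := by
    intro L
    induction L with
    | nil =>
      have : (listValue A []).1 = 1 := rfl
      rw [this]
      simp [wordMat]
    | cons p L ih =>
      have h1 : wordMat b (p :: L) = cond p.2 (b p.1) (b p.1).adjugate * wordMat b L := by
        simp [wordMat]
      have h2 : M * cond p.2 (b p.1) (b p.1).adjugate =
          c p.1 • ((cond p.2 (A p.1) (A p.1)⁻¹).1 * M) := by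
        rcases p with ⟨i, _ | _⟩
        · exact hadj i
        · exact h i
      have h3 : (listValue A (p :: L)).1 =
          (cond p.2 (A p.1) (A p.1)⁻¹).1 * (listValue A L).1 := by rw [listValue_cons]; rfl
      rw [h1, ← mul_assoc, h2, Matrix.smul_mul, mul_assoc, ih, h3, List.map_cons, List.prod_cons,
        Matrix.mul_smul, smul_smul, mul_assoc]
  have htr : ∀ L : List (Fin (2 * g) × Bool), (wordMat b L).trace =
      (L.map fun p => c p.1).prod * (listValue A L).1.trace := by
    intro L
    have h1 : wordMat b L = M⁻¹ * (M * wordMat b L) := by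
      rw [← mul_assoc, Matrix.nonsing_inv_mul M hu, one_mul]
    rw [h1, hword, Matrix.mul_smul, Matrix.trace_smul, smul_eq_mul, Matrix.trace_mul_comm,
      mul_assoc, Matrix.mul_nonsing_inv M hu, mul_one]
  have hwd : ∀ L : List (Fin (2 * g) × Bool), wordDet b L = (L.map fun p => c p.1).prod ^ 2 := by
    intro L
    induction L with
    | nil => simp [wordDet]
    | cons p L ih =>
      have h1 : wordDet b (p :: L) = c p.1 ^ 2 * wordDet b L := by
        rw [← hdet p.1]; simp [wordDet, hb]
      rw [h1, ih, List.map_cons, List.prod_cons, mul_pow]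
  have hΛ : 0 ≤ ∑ i, c i ^ 2 := Finset.sum_nonneg fun i _ => sq_nonneg (c i)
  refine ⟨1 + ∑ i, c i ^ 2, by linarith, fun W => wordDet b W.toWord, fun W => ⟨?_, ?_⟩,
    fun W₁ W₂ => ?_⟩
  · change 0 < wordDet b W.toWord
    rw [hwd]
    have : (W.toWord.map fun p => c p.1).prod ≠ 0 := by
      refine List.prod_ne_zero fun h0 => ?_
      obtain ⟨p, -, hp⟩ := List.mem_map.mp h0
      exact hc _ hp
    positivity
  · have key : ∀ L : List (Fin (2 * g) × Bool), 0 ≤ wordDet b L ∧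
        wordDet b L ≤ (1 + ∑ i, c i ^ 2) ^ L.length := by
      intro L
      induction L with
      | nil => simp [wordDet]
      | cons p L ih =>
        have h1 : wordDet b (p :: L) = c p.1 ^ 2 * wordDet b L := by
          rw [← hdet p.1]; simp [wordDet, hb]
        have h2 : c p.1 ^ 2 ≤ 1 + ∑ i, c i ^ 2 := by
          have := Finset.single_le_sum (f := fun i => c i ^ 2) (fun i _ => sq_nonneg _)
            (Finset.mem_univ p.1)
          linarith
        rw [h1, List.length_cons, pow_succ' _ L.length]
        exact ⟨mul_nonneg (sq_nonneg _) ih.1,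
          mul_le_mul h2 ih.2 ih.1 ((sq_nonneg _).trans h2)⟩
    exact (key _).2
  · have h1 := map_gapNumerator (MvPolynomial.aeval (R := ℤ) x).toRingHom B W₁.toWord W₂.toWord
    have h2 : (MvPolynomial.aeval x (gapNumerator B W₁.toWord W₂.toWord) : ℝ) =
      gapNumerator b W₁.toWord W₂.toWord := h1
    change _ = wordDet b W₁.toWord * wordDet b W₂.toWord * _
    rw [h2, gapNumerator, htr, htr, evalWord_eq_listValue, evalWord_eq_listValue, hwd, hwd]
    ring

/-- Traces grow at most exponentially in the word length. -/
theorem exists_abs_trace_evalWord_le (A : Fin (2 * g) → SL(2, ℝ)) :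
    ∃ m : ℝ, 1 ≤ m ∧ ∀ W, |(evalWord A W).1.trace| ≤ 2 * m ^ W.norm := by
  -- The factor 2 pays for the two terms in each entry of a product.
  set m : ℝ := 1 + ∑ i, ∑ a, ∑ b, 2 * |(A i).1 a b| with hm
  have hent : ∀ i a b, 2 * |(A i).1 a b| ≤ m := by
    intro i a b
    have h1 := Finset.single_le_sum (f := fun b => 2 * |(A i).1 a b|)
      (fun b _ => by positivity) (Finset.mem_univ b)
    have h2 := Finset.single_le_sum (f := fun a => ∑ b, 2 * |(A i).1 a b|)
      (fun b _ => by positivity) (Finset.mem_univ a)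
    have h3 := Finset.single_le_sum (f := fun i => ∑ a, ∑ b, 2 * |(A i).1 a b|)
      (fun b _ => by positivity) (Finset.mem_univ i)
    beta_reduce at h1 h2 h3
    linarith
  have hm1 : 1 ≤ m := by
    have : 0 ≤ ∑ i, ∑ a, ∑ b, 2 * |(A i).1 a b| := by positivity
    linarith
  have key : ∀ L a b, |(listValue A L).1 a b| ≤ m ^ L.length := by
    intro L
    induction L with
    | nil =>
      intro a b
      have : (listValue A []).1 = 1 := rfl
      rw [this, Matrix.one_apply]
      split_ifs <;> simp
    | cons p L ih =>
      intro a b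
      have h3 : (listValue A (p :: L)).1 =
          (cond p.2 (A p.1) (A p.1)⁻¹).1 * (listValue A L).1 := by rw [listValue_cons]; rfl
      have h4 : ∀ a b, 2 * |(cond p.2 (A p.1) (A p.1)⁻¹).1 a b| ≤ m := by
        intro a b
        rcases p with ⟨i, _ | _⟩
        · have : (cond false (A i) (A i)⁻¹).1 = (A i).1.adjugate := rfl
          rw [this, Matrix.adjugate_fin_two]
          have h5 := hent i
          generalize (A i).1 = C at h5
          fin_cases a <;> fin_cases b <;> simp [h5]
        · exact hent i a b
      rw [h3, Matrix.mul_apply, Fin.sum_univ_two, List.length_cons, pow_succ']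
      refine (abs_add_le _ _).trans ?_
      rw [abs_mul, abs_mul]
      have h5 := mul_le_mul (h4 a 0) (ih 0 b) (abs_nonneg _) (by linarith)
      have h6 := mul_le_mul (h4 a 1) (ih 1 b) (abs_nonneg _) (by linarith)
      linarith
  refine ⟨m, hm1, fun W => ?_⟩
  rw [evalWord_eq_listValue, Matrix.trace_fin_two]
  refine (abs_add_le _ _).trans ?_
  have h1 := key W.toWord 0 0
  have h2 := key W.toWord 1 1
  change _ ≤ 2 * m ^ W.toWord.length
  linarith

end charts

/-! ### From trace gaps to length gaps -/

theorem cosh_sub_cosh_le {a b : ℝ} (ha : 0 ≤ a) (hab : a < b) :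
    Real.cosh b - Real.cosh a ≤ (b - a) * Real.cosh b := by
  obtain ⟨c, hc, h⟩ := exists_deriv_eq_slope Real.cosh hab Real.continuous_cosh.continuousOn
    Real.differentiable_cosh.differentiableOn
  rw [Real.deriv_cosh, eq_div_iff (by linarith)] at h
  rw [← h, mul_comm]
  have h1 : Real.sinh c ≤ Real.cosh c := by
    have := Real.cosh_sub_sinh c
    have := Real.exp_pos (-c)
    linarith
  have h2 : Real.cosh c ≤ Real.cosh b := Real.cosh_le_cosh.mpr (by
    rw [abs_of_nonneg (by linarith [hc.1]), abs_of_nonneg (by linarith)]; exact hc.2.le)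
  have : 0 ≤ b - a := by linarith
  gcongr
  linarith

/-- Lower bounds for differences of squares of traces give lower bounds for differences of lengths
of closed geodesics. -/
theorem exists_le_abs_geodesicLength_sub {g N : ℕ}
    {B : Fin (2 * g) → Matrix (Fin 2) (Fin 2) (MvPolynomial (Fin N) ℤ)}
    {H : Matrix (Fin 2) (Fin 2) (MvPolynomial (Fin N) ℤ)} {x : Fin N → ℝ}
    {A : Fin (2 * g) → SL(2, ℝ)} (h : RepresentedAt B H x A) {K r : ℝ} {d : ℕ} (hK : 0 < K)
    (hr : 0 < r) (hr1 : r < 1)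
    (hgap : ∀ W₁ W₂ : FreeGroup (Fin (2 * g)),
      MvPolynomial.aeval x (gapNumerator B W₁.toWord W₂.toWord) = 0 ∨
      K * r ^ (2 * d * (W₁.norm + W₂.norm) ^ 2) ≤
        |MvPolynomial.aeval x (gapNumerator B W₁.toWord W₂.toWord)|) :
    ∃ K' c : ℝ, 0 < K' ∧ 0 < c ∧ ∀ W₁ W₂ : FreeGroup (Fin (2 * g)),
      geodesicLength W₁ A = geodesicLength W₂ A ∨
      K' * c ^ (max W₁.norm W₂.norm) * r ^ (8 * d * (max W₁.norm W₂.norm) ^ 2) ≤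
        |geodesicLength W₁ A - geodesicLength W₂ A| := by
  obtain ⟨Λ, hΛ, δ, hδ, hgapeq⟩ := h.exists_aeval_gapNumerator_eq
  obtain ⟨m, hm, htr⟩ := exists_abs_trace_evalWord_le A
  have key : ∀ W₁ W₂ : FreeGroup (Fin (2 * g)), geodesicLength W₂ A < geodesicLength W₁ A →
      (K / 4) * ((Λ * m) ^ 2)⁻¹ ^ (max W₁.norm W₂.norm) *
        r ^ (8 * d * (max W₁.norm W₂.norm) ^ 2) ≤ geodesicLength W₁ A - geodesicLength W₂ A := by
    intro W₁ W₂ hlt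
    set n := max W₁.norm W₂.norm with hn
    have hl2 := geodesicLength_nonneg W₂ A
    have hcosh : Real.cosh (geodesicLength W₂ A) < Real.cosh (geodesicLength W₁ A) := by
      rw [Real.cosh_lt_cosh, abs_of_nonneg hl2, abs_of_nonneg (by linarith)]
      exact hlt
    have hc1 : Real.cosh (geodesicLength W₁ A) = (evalWord A W₁).1.trace ^ 2 / 2 - 1 := by
      have h1 := cosh_geodesicLength W₁ A
      rcases max_choice 1 ((evalWord A W₁).1.trace ^ 2 / 2 - 1) with h2 | h2
      · have := Real.one_le_cosh (geodesicLength W₂ A)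
        linarith
      · rw [h1, h2]
    -- If the trace formula fails for `W₂`, its length is zero. The empty word has the same length,
    -- obeys the formula and is no longer than `W₂`.
    obtain ⟨W', hW', hc2⟩ : ∃ W' : FreeGroup (Fin (2 * g)), W'.norm ≤ n ∧
        Real.cosh (geodesicLength W₂ A) = (evalWord A W').1.trace ^ 2 / 2 - 1 := by
      have h1 := cosh_geodesicLength W₂ A
      rcases max_choice 1 ((evalWord A W₂).1.trace ^ 2 / 2 - 1) with h2 | h2
      · refine ⟨1, by simp, ?_⟩
        have h3 : (evalWord A (1 : FreeGroup (Fin (2 * g)))).1 = 1 := by rw [map_one]; rfl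
        rw [h1, h2, h3]
        simp
        norm_num
      · exact ⟨W₂, le_max_right _ _, h1.trans h2⟩
    have hpos : 0 < (evalWord A W₁).1.trace ^ 2 - (evalWord A W').1.trace ^ 2 := by linarith
    have hW₁ : W₁.norm ≤ n := le_max_left _ _
    have hΛ0 : 0 < Λ := by linarith
    have hm0 : 0 < m := by linarith
    have hδle : ∀ W : FreeGroup (Fin (2 * g)), W.norm ≤ n → δ W ≤ Λ ^ n := fun W hW =>
      (hδ W).2.trans (pow_le_pow_right₀ hΛ hW)
    have hlow : K * r ^ (8 * d * n ^ 2) ≤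
        Λ ^ n * Λ ^ n * ((evalWord A W₁).1.trace ^ 2 - (evalWord A W').1.trace ^ 2) := by
      have hne : MvPolynomial.aeval x (gapNumerator B W₁.toWord W'.toWord) ≠ (0 : ℝ) := by
        rw [hgapeq]
        exact (mul_pos (mul_pos (hδ W₁).1 (hδ W').1) hpos).ne'
      have h1 := (hgap W₁ W').resolve_left hne
      rw [hgapeq, abs_of_pos (mul_pos (mul_pos (hδ W₁).1 (hδ W').1) hpos)] at h1
      calc K * r ^ (8 * d * n ^ 2) ≤ K * r ^ (2 * d * (W₁.norm + W'.norm) ^ 2) := by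
            gcongr K * ?_
            apply pow_le_pow_of_le_one hr.le hr1.le
            calc 2 * d * (W₁.norm + W'.norm) ^ 2 ≤ 2 * d * (n + n) ^ 2 := by gcongr
              _ = _ := by ring
        _ ≤ _ := h1
        _ ≤ _ := by
          gcongr
          · exact (hδ W').1.le
          · exact hδle _ hW₁
          · exact hδle _ hW'
    have hup : Real.cosh (geodesicLength W₁ A) ≤ 2 * (m ^ n) ^ 2 := by
      have h1 : (evalWord A W₁).1.trace ^ 2 ≤ (2 * m ^ n) ^ 2 := by
        rw [← sq_abs]
        gcongr
        exact (htr W₁).trans (by gcongr)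
      rw [hc1]
      nlinarith
    have hfin := cosh_sub_cosh_le hl2 hlt
    have hD : 0 < geodesicLength W₁ A - geodesicLength W₂ A := by linarith
    have h2 : K * r ^ (8 * d * n ^ 2) ≤ ((Λ * m) ^ 2) ^ n * 4 *
        (geodesicLength W₁ A - geodesicLength W₂ A) := by
      calc _ ≤ Λ ^ n * Λ ^ n * ((evalWord A W₁).1.trace ^ 2 - (evalWord A W').1.trace ^ 2) := hlow
        _ ≤ Λ ^ n * Λ ^ n * (2 * ((geodesicLength W₁ A - geodesicLength W₂ A) *
              (2 * (m ^ n) ^ 2))) := by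
            gcongr
            calc _ = 2 * (Real.cosh (geodesicLength W₁ A) - Real.cosh (geodesicLength W₂ A)) := by
                  rw [hc1, hc2]; ring
              _ ≤ 2 * ((geodesicLength W₁ A - geodesicLength W₂ A) *
                    Real.cosh (geodesicLength W₁ A)) := by gcongr
              _ ≤ _ := by gcongr
        _ = _ := by
            rw [pow_right_comm, mul_pow]; ring
    have hq : 0 < ((Λ * m) ^ 2) ^ n := by positivity
    rw [inv_pow]
    have h3 : K / 4 * (((Λ * m) ^ 2) ^ n)⁻¹ * r ^ (8 * d * n ^ 2) =
        (K * r ^ (8 * d * n ^ 2)) / (((Λ * m) ^ 2) ^ n * 4) := by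
      field_simp
    rw [h3, div_le_iff₀ (by positivity)]
    linarith
  refine ⟨K / 4, ((Λ * m) ^ 2)⁻¹, by positivity, by positivity, fun W₁ W₂ => ?_⟩
  rcases lt_trichotomy (geodesicLength W₁ A) (geodesicLength W₂ A) with hlt | heq | hlt
  · right
    rw [max_comm, abs_sub_comm]
    exact (key W₂ W₁ hlt).trans (le_abs_self _)
  · exact Or.inl heq
  · right
    exact (key W₁ W₂ hlt).trans (le_abs_self _)

/-! ### Word length and geodesic length on a closed surface -/

theorem geodesicLength_one {g : ℕ} (A : Fin (2 * g) → SL(2, ℝ)) :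
    geodesicLength (1 : FreeGroup (Fin (2 * g))) A = 0 := by
  have h1 := cosh_geodesicLength (1 : FreeGroup (Fin (2 * g))) A
  have h3 : (evalWord A (1 : FreeGroup (Fin (2 * g)))).1 = 1 := by rw [map_one]; rfl
  rw [h3] at h1
  by_contra hne
  have h4 := Real.one_lt_cosh.mpr hne
  rw [h1, Matrix.trace_one] at h4
  norm_num at h4

/-- On a closed surface, a closed geodesic of length `ℓ` is represented by a word of length
`O(ℓ + 1)`. -/
theorem DefinesSurface.exists_norm_le {g : ℕ} {A : Fin (2 * g) → SL(2, ℝ)}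
    (hA : DefinesSurface A) : ∃ C : ℝ, 0 < C ∧ ∀ W : FreeGroup (Fin (2 * g)),
      ∃ W' : FreeGroup (Fin (2 * g)), geodesicLength W' A = geodesicLength W A ∧
        (W'.norm : ℝ) ≤ C * (geodesicLength W A + 1) := by
  obtain ⟨D, hD, hcov⟩ := hA.cocompact
  obtain ⟨R, hR⟩ := hD.isBounded.subset_closedBall UpperHalfPlane.I
  have hcov' : ∀ z : ℍ, ∃ V : FreeGroup (Fin (2 * g)),
      dist (evalWord A V • z) UpperHalfPlane.I ≤ R := by
    intro z
    obtain ⟨_, ⟨V, rfl⟩, hV⟩ := hcov z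
    exact ⟨V, hR hV⟩
  have hfin := hA.properlyDiscontinuous (Metric.closedBall UpperHalfPlane.I (R + 1))
    (isCompact_closedBall _ _)
  obtain ⟨L, hL⟩ : ∃ L : ℕ, ∀ γ : SL(2, ℝ), γ ∈ (evalWord A).range →
      ∀ z : ℍ, dist z UpperHalfPlane.I ≤ R + 1 → dist (γ • z) UpperHalfPlane.I ≤ R + 1 →
        ∃ U : FreeGroup (Fin (2 * g)), evalWord A U = γ ∧ U.norm ≤ L := by
    have hword : ∀ γ : SL(2, ℝ), ∃ U : FreeGroup (Fin (2 * g)),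
        γ ∈ (evalWord A).range → evalWord A U = γ := by
      intro γ
      by_cases h : γ ∈ (evalWord A).range
      · obtain ⟨U, hU⟩ := h
        exact ⟨U, fun _ => hU⟩
      · exact ⟨1, fun h' => absurd h' h⟩
    choose w hw using hword
    refine ⟨hfin.toFinset.sup fun γ => (w γ).norm, fun γ hγ z hz1 hz2 => ⟨w γ, hw γ hγ, ?_⟩⟩
    exact Finset.le_sup (f := fun γ => (w γ).norm)
      (hfin.mem_toFinset.mpr ⟨hγ, z, Metric.mem_closedBall.mpr hz1, Metric.mem_closedBall.mpr hz2⟩)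
  have key : ∀ (W : FreeGroup (Fin (2 * g))) (ℓ : ℝ) (c : ℝ → ℍ), 0 < ℓ → Isometry c →
      (∀ t, c (t + ℓ) = evalWord A W • c t) → dist (c 0) UpperHalfPlane.I ≤ R →
      ∃ W' : FreeGroup (Fin (2 * g)), evalWord A W' = evalWord A W ∧
        W'.norm ≤ (⌈ℓ⌉₊ + 1) * L := by
    intro W ℓ c hℓ hc hW h0
    have hn : 0 < ⌈ℓ⌉₊ := Nat.ceil_pos.mpr hℓ
    have hn' : (0 : ℝ) < ⌈ℓ⌉₊ := by exact_mod_cast hn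
    set s := ℓ / ⌈ℓ⌉₊ with hs
    have hs0 : 0 ≤ s := by positivity
    have hs1 : s ≤ 1 := (div_le_one hn').mpr (Nat.le_ceil ℓ)
    -- The segment from `c 0` to `c ℓ` is cut into steps of length at most 1 and every division
    -- point is carried back to the ball of radius `R`. Consecutive carrying elements differ by one
    -- that moves some point of the ball of radius `R + 1` into that ball, hence by a word of length
    -- at most `L`.
    have walk : ∀ n : ℕ, ∃ V : FreeGroup (Fin (2 * g)), V.norm ≤ n * L ∧
        dist (evalWord A V • c (n * s)) UpperHalfPlane.I ≤ R := by
      intro n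
      induction n with
      | zero => exact ⟨1, by simp, by simpa using h0⟩
      | succ n ih =>
        obtain ⟨V, hV1, hV2⟩ := ih
        obtain ⟨V', hV'⟩ := hcov' (c ((n + 1 : ℕ) * s))
        have hd : dist (c ((n + 1 : ℕ) * s)) (c (n * s)) ≤ 1 := by
          rw [hc.dist_eq, Real.dist_eq]
          have : ((n + 1 : ℕ) : ℝ) * s - n * s = s := by push_cast; ring
          rw [this, abs_of_nonneg hs0]
          exact hs1
        obtain ⟨U, hU1, hU2⟩ := hL (evalWord A (V' * V⁻¹)) ⟨_, rfl⟩
          (evalWord A V • c ((n + 1 : ℕ) * s))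
          (by
            have := dist_triangle (evalWord A V • c ((n + 1 : ℕ) * s)) (evalWord A V • c (n * s))
              UpperHalfPlane.I
            rw [dist_smul] at this
            linarith)
          (by
            rw [← mul_smul, ← map_mul, inv_mul_cancel_right]
            linarith)
        refine ⟨U * V, ?_, ?_⟩
        · refine (FreeGroup.norm_mul_le U V).trans ?_
          rw [add_mul, one_mul]
          omega
        · rw [map_mul, hU1, ← map_mul, inv_mul_cancel_right]
          exact hV'
    obtain ⟨V, hV1, hV2⟩ := walk ⌈ℓ⌉₊
    have hend : c (⌈ℓ⌉₊ * s) = evalWord A W • c 0 := by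
      rw [← hW, zero_add, hs, mul_div_cancel₀ _ hn'.ne']
    rw [hend, ← mul_smul, ← map_mul] at hV2
    obtain ⟨U, hU1, hU2⟩ := hL (evalWord A (V * W)) ⟨_, rfl⟩ (c 0) (by linarith) (by linarith)
    refine ⟨V⁻¹ * U, ?_, ?_⟩
    · rw [map_mul, hU1, ← map_mul, inv_mul_cancel_left]
    · refine (FreeGroup.norm_mul_le _ _).trans ?_
      rw [FreeGroup.norm_inv_eq, add_mul, one_mul]
      omega
  refine ⟨2 * L + 1, by positivity, fun W => ?_⟩
  have hnn := geodesicLength_nonneg W A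
  by_cases hW : geodesicLength W A = 0
  · exact ⟨1, by rw [geodesicLength_one, hW], by rw [FreeGroup.norm_one]; simp; positivity⟩
  · obtain ⟨hl, c, hc, hcW⟩ := isClosedGeodesicLength_geodesicLength_of_ne_zero hW
    -- Conjugation keeps the length and brings the axis near `I`, as the walk requires.
    obtain ⟨V, hV⟩ := hcov' (c 0)
    have hc' : Isometry fun t => evalWord A V • c t := (isometry_smul ℍ (evalWord A V)).comp hc
    obtain ⟨W', h1, h2⟩ := key (V * W * V⁻¹) _ (fun t => evalWord A V • c t) (hnn.lt_of_ne' hW) hc'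
      (fun t => by
        rw [hcW, ← mul_smul, ← mul_smul, ← map_mul, ← map_mul, inv_mul_cancel_right]) hV
    have hW' : IsClosedGeodesicLength W' A (geodesicLength W A) :=
      ⟨hl, _, hc', fun t => by
        rw [h1, hcW, ← mul_smul, ← mul_smul, ← map_mul, ← map_mul, inv_mul_cancel_right]⟩
    refine ⟨W', hW'.eq, ?_⟩
    have h3 : (W'.norm : ℝ) ≤ (⌈geodesicLength W A⌉₊ + 1) * L := by exact_mod_cast h2
    have h4 := Nat.ceil_lt_add_one hnn
    calc (W'.norm : ℝ) ≤ (⌈geodesicLength W A⌉₊ + 1) * L := h3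
      _ ≤ (geodesicLength W A + 1 + 1) * L := by gcongr
      _ ≤ (2 * L + 1) * (geodesicLength W A + 1) := by
          have hL0 : (0 : ℝ) ≤ L := by positivity
          nlinarith [mul_nonneg hL0 hnn]

/-- On a closed surface, gaps bounded below in terms of word lengths are bounded below in terms of
the lengths of geodesics. -/
theorem DefinesSurface.exists_exp_le {g : ℕ} {A : Fin (2 * g) → SL(2, ℝ)} (hA : DefinesSurface A)
    {q a K : ℝ} (hq : 1 < q) (ha : 0 < a) (hK : 0 < K)
    (h : ∀ W₁ W₂ : FreeGroup (Fin (2 * g)), geodesicLength W₁ A = geodesicLength W₂ A ∨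
      K * q ^ (-(a * (max (W₁.norm : ℝ) (W₂.norm : ℝ)) ^ 2)) ≤
        |geodesicLength W₁ A - geodesicLength W₂ A|) :
    ∃ K R : ℝ, 0 < K ∧ 0 < R ∧ ∀ W₁ W₂ : FreeGroup (Fin (2 * g)),
      geodesicLength W₁ A = geodesicLength W₂ A ∨
      K * Real.exp (-(R * geodesicLength W₁ A ^ 2)) ≤
        |geodesicLength W₁ A - geodesicLength W₂ A| := by
  obtain ⟨C, hC, hnorm⟩ := hA.exists_norm_le
  have hlog : 0 < Real.log q := Real.log_pos hq
  set s := Real.log q * (a * C ^ 2) with hs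
  have hs0 : 0 < s := by positivity
  refine ⟨min 1 (K * Real.exp (-(8 * s))), 2 * s, by positivity, by positivity, fun W₁ W₂ => ?_⟩
  obtain ⟨V₁, h1, hV₁⟩ := hnorm W₁
  obtain ⟨V₂, h2, hV₂⟩ := hnorm W₂
  have hn1 := geodesicLength_nonneg W₁ A
  have hn2 := geodesicLength_nonneg W₂ A
  rcases h V₁ V₂ with heq | hge
  · left; rw [← h1, ← h2, heq]
  right
  rw [h1, h2] at hge
  set l₁ := geodesicLength W₁ A
  set l₂ := geodesicLength W₂ A
  -- The bound involves only `l₁`: either `l₂` exceeds it by more than 1 and the gap is trivially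
  -- large, or both word lengths are controlled by `l₁`.
  rcases lt_or_ge (l₁ + 1) l₂ with hfar | hnear
  · have h3 : Real.exp (-(2 * s * l₁ ^ 2)) ≤ 1 := Real.exp_le_one_iff.mpr (by
      have : 0 ≤ 2 * s * l₁ ^ 2 := by positivity
      linarith)
    calc _ ≤ 1 * 1 := by
          gcongr
          exact min_le_left _ _
      _ ≤ |l₁ - l₂| := by rw [abs_sub_comm, abs_of_pos (by linarith)]; linarith
  · refine le_trans ?_ hge
    have hmax : max (V₁.norm : ℝ) (V₂.norm : ℝ) ≤ C * (l₁ + 2) :=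
      max_le (hV₁.trans (mul_le_mul_of_nonneg_left (by linarith) hC.le))
        (hV₂.trans (mul_le_mul_of_nonneg_left (by linarith) hC.le))
    have hmax0 : 0 ≤ max (V₁.norm : ℝ) (V₂.norm : ℝ) := le_max_of_le_left (by positivity)
    calc _ ≤ (K * Real.exp (-(8 * s))) * Real.exp (-(2 * s * l₁ ^ 2)) := by
          gcongr
          exact min_le_right _ _
      _ = K * Real.exp (-(s * (2 * l₁ ^ 2 + 8))) := by
          rw [mul_assoc, ← Real.exp_add]
          congr 2
          ring
      _ ≤ _ := by
          rw [Real.rpow_def_of_pos (by linarith)]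
          gcongr
          have h4 : (max (V₁.norm : ℝ) (V₂.norm : ℝ)) ^ 2 ≤ (C * (l₁ + 2)) ^ 2 := by gcongr
          have h5 : (C * (l₁ + 2)) ^ 2 ≤ C ^ 2 * (2 * l₁ ^ 2 + 8) := by
            rw [mul_pow]
            gcongr
            nlinarith [sq_nonneg (l₁ - 2)]
          have h6 := mul_le_mul_of_nonneg_left (h4.trans h5)
            (mul_nonneg hlog.le ha.le)
          rw [hs]
          linarith

/-! ### Assembling the almost everywhere statements -/

open MeasureTheory in
/-- Representation at points outside a null set is enough for an almost everywhere statement. -/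
theorem almostEverySurfaceTuple_of_forall_representedAt {k : ℕ}
    {P : (Fin (2 * (k + 2)) → SL(2, ℝ)) → Prop}
    (Z : (Fin (2 * (k + 2)) → Matrix (Fin 2) (Fin 2) (MvPolynomial (Fin (6 * k + 9)) ℤ)) →
      Set (Fin (6 * k + 9) → ℝ))
    (hZ : ∀ B, (∀ i a b, (B i a b).totalDegree ≤ 8 * k + 4) → volume (Z B) = 0)
    (hP : ∀ A B H x, (∀ i a b, (B i a b).totalDegree ≤ 8 * k + 4) → RepresentedAt B H x A →
      x ∉ Z B → P A) : AlmostEverySurfaceTuple (k + 2) P := by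
  have hs : (6 * ((k + 2 : ℕ) : ℝ) - 3) = (6 * k + 9 : ℕ) := by push_cast; ring
  rw [AlmostEverySurfaceTuple, hs]
  have hs0 : (0 : ℝ) ≤ (6 * k + 9 : ℕ) := by positivity
  have hsub : entries '' {A | A ∈ surfaceTuples (k + 2) ∧ ¬ P A} ⊆
      entries '' {A | ∃ B : Fin (2 * (k + 2)) → Matrix (Fin 2) (Fin 2)
          (MvPolynomial (Fin (6 * k + 9)) ℤ), ∃ H x,
          (∀ i a b, (B i a b).totalDegree ≤ 8 * k + 4) ∧ x ∈ Z B ∧ RepresentedAt B H x A} ∪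
      entries '' {A | ∃ B : Fin (2 * (k + 2)) → Matrix (Fin 2) (Fin 2)
          (MvPolynomial (Fin (6 * k + 8)) ℤ), ∃ H x, True ∧ x ∈ Set.univ ∧
          RepresentedAt B H x A} := by
    rw [← Set.image_union]
    refine Set.image_mono fun A hA => ?_
    rcases exists_representedAt_of_mem_surfaceTuples hA.1 with ⟨B, H, x, hB, h⟩ | ⟨B, H, x, h⟩
    · left
      exact ⟨B, H, x, hB, by_contra fun hx => hA.2 (hP A B H x hB h hx), h⟩
    · right
      exact ⟨B, H, x, trivial, trivial, h⟩
  refine measure_mono_null hsub (measure_union_null ?_ ?_)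
  · refine hausdorffMeasure_entries_image_eq_zero hs0 _ Z (fun B hB => ?_) fun A hA => hA
    have : (μH[(6 * k + 9 : ℕ)] : Measure (Fin (6 * k + 9) → ℝ)) = volume := by
      have := hausdorffMeasure_pi_real (ι := Fin (6 * k + 9))
      rwa [Fintype.card_fin] at this
    rw [this]
    exact hZ B hB
  · refine hausdorffMeasure_entries_image_eq_zero hs0 _ (fun _ => Set.univ) (fun B _ => ?_)
      fun A hA => hA
    have := hausdorffMeasure_of_dimH_lt (s := (Set.univ : Set (Fin (6 * k + 8) → ℝ)))
      (d := ((6 * k + 9 : ℕ) : NNReal)) (by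
        rw [Real.dimH_univ_pi_fin]
        norm_cast
        omega)
    exact_mod_cast this

/-- Almost every solution of the surface relation satisfies a lower bound for the gaps between
lengths of closed geodesics. -/
theorem almostEverySurfaceTuple_gap (k : ℕ) {η : ℝ} (hη : 0 < η) :
    AlmostEverySurfaceTuple (k + 2) fun A =>
      ∃ K : ℝ, 0 < K ∧ ∀ W₁ W₂ : FreeGroup (Fin (2 * (k + 2))),
        geodesicLength W₁ A = geodesicLength W₂ A ∨
        K * (4 * ((k + 2 : ℕ) : ℝ) - 1) ^
            (-(((2 * ((k + 2 : ℕ) : ℝ) + 4) * (4 * ((k + 2 : ℕ) : ℝ) - 2) + η) *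
            (max (W₁.norm : ℝ) (W₂.norm : ℝ)) ^ 2)) ≤
          |geodesicLength W₁ A - geodesicLength W₂ A| := by
  obtain ⟨q, hq⟩ : ∃ q, q = 4 * ((k + 2 : ℕ) : ℝ) - 1 := ⟨_, rfl⟩
  have hq1 : 1 < q := by rw [hq]; push_cast; linarith [Nat.cast_nonneg (α := ℝ) k]
  have hq0 : 0 < q := by linarith
  -- Any exponent below -1 makes Borel-Cantelli converge. This one turns `8 * (8 * k + 4)` into `66
  -- * k + 33`, still within the claimed coefficient.
  set r : ℝ := q ^ (-(33 / 32) : ℝ) with hr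
  have hr0 : 0 < r := by positivity
  have hr1 : r < 1 := Real.rpow_lt_one_of_one_lt_of_neg hq1 (by norm_num)
  have hqr : ((2 * (2 * (k + 2)) - 1 : ℕ) : ℝ) * r < 1 := by
    have h1 : ((2 * (2 * (k + 2)) - 1 : ℕ) : ℝ) = q := by
      rw [hq, Nat.cast_sub (by omega)]; push_cast; ring
    rw [h1, hr]
    nth_rewrite 1 [← Real.rpow_one q]
    rw [← Real.rpow_add hq0]
    exact Real.rpow_lt_one_of_one_lt_of_neg hq1 (by norm_num)
  refine almostEverySurfaceTuple_of_forall_representedAt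
    (fun B => {x | ¬ ∃ K : ℝ, 0 < K ∧ ∀ W₁ W₂ : FreeGroup (Fin (2 * (k + 2))),
      MvPolynomial.aeval x (gapNumerator B W₁.toWord W₂.toWord) = 0 ∨
      K * r ^ (2 * (8 * k + 4) * (W₁.norm + W₂.norm) ^ 2) ≤
        |MvPolynomial.aeval x (gapNumerator B W₁.toWord W₂.toWord)|}) (fun B hB => ?_)
    (fun A B H x hB hrep hx => ?_)
  · exact ae_exists_le_abs_aeval_gapNumerator (by omega) hB hr0 hqr
  · obtain ⟨K, hK, hgap⟩ := not_not.mp hx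
    obtain ⟨K', c, hK', hc, h⟩ := exists_le_abs_geodesicLength_sub hrep hK hr0 hr1 hgap
    have hlog : 0 < Real.log q := Real.log_pos hq1
    set a := -Real.log c / Real.log q with ha
    have hca : c = q ^ (-a) := by
      rw [Real.rpow_def_of_pos hq0, ha, neg_div, neg_neg, mul_div_cancel₀ _ hlog.ne',
        Real.exp_log hc]
    -- The factor `c ^ n = q ^ (-(a * n))` is absorbed by `η * n ^ 2` after completing the square;
    -- the remaining constant goes into `K`.
    refine ⟨K' * q ^ (-(a ^ 2 / (4 * η))), by positivity, fun W₁ W₂ => ?_⟩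
    refine (h W₁ W₂).imp id fun hle => le_trans ?_ hle
    rw [← hq, ← Nat.cast_max]
    generalize max W₁.norm W₂.norm = n
    have e1 : c ^ n = q ^ (-(a * n)) := by
      rw [hca, ← Real.rpow_natCast, ← Real.rpow_mul hq0.le]; ring_nf
    have e2 : r ^ (8 * (8 * k + 4) * n ^ 2) = q ^ (-((66 * k + 33) * (n : ℝ) ^ 2)) := by
      rw [hr, ← Real.rpow_natCast, ← Real.rpow_mul hq0.le]
      congr 1
      push_cast
      ring
    rw [e1, e2, mul_assoc, mul_assoc, ← Real.rpow_add hq0, ← Real.rpow_add hq0]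
    refine mul_le_mul_of_nonneg_left (Real.rpow_le_rpow_of_exponent_le hq1.le ?_) hK'.le
    have h1 : a * n ≤ η * (n : ℝ) ^ 2 + a ^ 2 / (4 * η) := by
      have : η * (n : ℝ) ^ 2 + a ^ 2 / (4 * η) - a * n = (2 * η * n - a) ^ 2 / (4 * η) := by
        field_simp; ring
      have h2 : 0 ≤ (2 * η * n - a) ^ 2 / (4 * η) := by positivity
      linarith
    have h2 : (66 * k + 33 : ℝ) ≤ (2 * ((k + 2 : ℕ) : ℝ) + 4) * (4 * ((k + 2 : ℕ) : ℝ) - 2) := by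
      push_cast
      -- This is the excess of the claimed coefficient. It is negative only between `5 / 4` and `3 /
      -- 2`, where there is no integer.
      have : (0 : ℝ) ≤ (4 * k - 5) * (2 * k - 3) := by
        rcases Nat.lt_or_ge k 2 with hk | hk
        · interval_cases k <;> norm_num
        · have : (2 : ℝ) ≤ k := by exact_mod_cast hk
          exact mul_nonneg (by linarith) (by linarith)
      linarith
    have h3 := mul_le_mul_of_nonneg_right h2 (sq_nonneg (n : ℝ))
    linarith

theorem mainTheorem4 (g : ℕ) (hg : 2 ≤ g) :
    (∀ η : ℝ, 0 < η → AlmostEverySurfaceTuple g fun A =>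
      ∃ K : ℝ, 0 < K ∧ ∀ W₁ W₂ : FreeGroup (Fin (2 * g)),
        geodesicLength W₁ A = geodesicLength W₂ A ∨
        K * (4 * (g : ℝ) - 1) ^ (-(((2 * (g : ℝ) + 4) * (4 * (g : ℝ) - 2) + η) *
            (max (W₁.norm : ℝ) (W₂.norm : ℝ)) ^ 2)) ≤
          |geodesicLength W₁ A - geodesicLength W₂ A|) ∧
    (AlmostEverySurfaceTuple g fun A => DefinesSurface A →
      ∃ K R : ℝ, 0 < K ∧ 0 < R ∧ ∀ W₁ W₂ : FreeGroup (Fin (2 * g)),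
        geodesicLength W₁ A = geodesicLength W₂ A ∨
        K * Real.exp (-(R * geodesicLength W₁ A ^ 2)) ≤
          |geodesicLength W₁ A - geodesicLength W₂ A|) := by
  obtain ⟨k, rfl⟩ : ∃ k, g = k + 2 := ⟨g - 2, by omega⟩
  refine ⟨fun η hη => almostEverySurfaceTuple_gap k hη, ?_⟩
  refine MeasureTheory.measure_mono_null (Set.image_mono ?_)
    (almostEverySurfaceTuple_gap k one_pos)
  intro A hA
  refine ⟨hA.1, fun hgap => hA.2 fun hS => ?_⟩
  obtain ⟨K, hK, h⟩ := hgap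
  have hk := Nat.cast_nonneg (α := ℝ) k
  have ha : 0 < (2 * ((k + 2 : ℕ) : ℝ) + 4) * (4 * ((k + 2 : ℕ) : ℝ) - 2) + 1 := by
    push_cast
    have : 0 ≤ (2 * ((k : ℝ) + 2) + 4) * (4 * (k + 2) - 2) :=
      mul_nonneg (by linarith) (by linarith)
    linarith
  exact hS.exists_exp_le (by push_cast; linarith) ha hK h
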